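/- Let $u_t+u_x=0$ be discretized in space on a uniform grid $x_j=jh$, $h>0$, with cell faces $x_{j+1/2}=(j+\tfrac12)h$, in terms of approximate cell averages $u_j$ of $u$ and $v_j$ of $u_x$. For integers $l,r\ge 0$ the conservative Hermite-WENO-type baseline method with stencil $(l,r)$ is $$u_j'=-\frac{\mathcal F_{j+1/2}-\mathcal F_{j-1/2}}{h},\qquad v_j'=-\frac{\mathcal H_{j+1/2}-\mathcal H_{j-1/2}}{h},$$ with the optimally accurate fluxes $\mathcal F_{j+1/2}=P(x_{j+1/2})$ and $\mathcal H_{j+1/2}=P'(x_{j+1/2})$, where $P=P_j$ is the polynomial of degree at most $2l+2r-1$ such that $$\frac1h\int_{x_{j+k-1/2}}^{x_{j+k+1/2}}P\,dx=u_{j+k},\qquad \frac1h\int_{x_{j+k-1/2}}^{x_{j+k+1/2}}P'\,dx=v_{j+k},\qquad -l+1\le k\le r .$$ For $\theta\in(0,2\pi)$ put $\kappa=\theta/h$. Under the ansatz $u_j=U\,e^{ij\theta}$, $v_j=i\kappa V e^{ij\theta}$ the method becomes $(U,V)^{T\prime}=-\frac1h M(\theta)\,(U,V)^T$ with a $2\times2$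 matrix $M(\theta)$; its trace $\tilde H(\theta)=\operatorname{tr}M(\theta)$ is called the trace symbol. Let $t\ge 0$ be an integer and take the stencil $(l,r)=(t+3,t)$. Then for every $h>0$: 1. for all data and all $j$ there is exactly one reconstruction polynomial $P_j$, so the method is well defined; 2. $\operatorname{Re}\tilde H(\pi)<0$; 3. the method is unstable: for every even number $N\ge 2$ of cells, the linear ODE system on the periodic grid ($u_{j+N}=u_j$, $v_{j+N}=v_j$) has an eigenvalue with positive real part. Moreover, with $H_k=\sum_{i=1}^k 1/i$ the harmonic numbers, for every integer $n\ge 0$ $$\sum_{k=0}^{2n+1}(-1)^kH_k\binom{2n+1}{k}^2=\frac{(-1)^{n+1}2^{4n}(n!)^2}{(2n+1)!}.$$ -/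

import Mathlib

open Polynomial

/-- The cell face `x_{j+1/2} = (j + 1/2) h` of the uniform grid `x_j = j h`;
cell `j` is the interval from `face h (j - 1)` to `face h j`. -/
noncomputable def face (h : ℝ) (j : ℤ) : ℝ := ((j : ℝ) + 1 / 2) * h

/-- The average `(1/h) ∫ P(x) dx` of a polynomial over cell `j`. -/
noncomputable def cellAverage (h : ℝ) (j : ℤ) (P : ℂ[X]) : ℂ :=
  (1 / (h : ℂ)) * ∫ x in (face h (j - 1))..(face h j), P.eval (x : ℂ)

/-- `P` is an optimally accurate (k-exact) Hermite reconstruction at the face `x_{j+1/2}`: it has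
degree at most `2l + 2r - 1`, and on each of the `l + r` cells `j - l + 1, …, j + r` of the stencil
the averages of `P` and of `P'` are the given data `u` and `v`. -/
def IsReconstruction (l r : ℕ) (h : ℝ) (u v : ℤ → ℂ) (j : ℤ) (P : ℂ[X]) : Prop :=
  P.degree < ((2 * l + 2 * r : ℕ) : WithBot ℕ) ∧
    ∀ k : ℤ, -(l : ℤ) + 1 ≤ k → k ≤ (r : ℤ) →
      cellAverage h (j + k) P = u (j + k) ∧
      cellAverage h (j + k) (derivative P) = v (j + k)

/-- The reconstruction polynomial at the face `x_{j+1/2}`. -/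
noncomputable def reconstruction (l r : ℕ) (h : ℝ) (u v : ℤ → ℂ) (j : ℤ) : ℂ[X] :=
  Classical.epsilon (IsReconstruction l r h u v j)

/-- The numerical flux for the cell averages of the solution, `P(x_{j+1/2})`. -/
noncomputable def fluxF (l r : ℕ) (h : ℝ) (u v : ℤ → ℂ) (j : ℤ) : ℂ :=
  (reconstruction l r h u v j).eval (face h j : ℂ)

/-- The numerical flux for the cell averages of the derivative, `P'(x_{j+1/2})`. -/
noncomputable def fluxH (l r : ℕ) (h : ℝ) (u v : ℤ → ℂ) (j : ℤ) : ℂ :=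
  (derivative (reconstruction l r h u v j)).eval (face h j : ℂ)

/-- The right-hand side of `u_j' = -(F_{j+1/2} - F_{j-1/2}) / h`. -/
noncomputable def rhsU (l r : ℕ) (h : ℝ) (u v : ℤ → ℂ) (j : ℤ) : ℂ :=
  -(fluxF l r h u v j - fluxF l r h u v (j - 1)) / (h : ℂ)

/-- The right-hand side of `v_j' = -(H_{j+1/2} - H_{j-1/2}) / h`. -/
noncomputable def rhsV (l r : ℕ) (h : ℝ) (u v : ℤ → ℂ) (j : ℤ) : ℂ :=
  -(fluxH l r h u v j - fluxH l r h u v (j - 1)) / (h : ℂ)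

/-- The Fourier mode `j ↦ exp(i j θ)`. -/
noncomputable def fourierMode (θ : ℝ) (j : ℤ) : ℂ :=
  Complex.exp (Complex.I * (j : ℂ) * (θ : ℂ))

/-- The von Neumann symbol `M(θ)`: under the ansatz `u_j = U(s) exp(i j θ)`,
`v_j = i κ V(s) exp(i j θ)` with `κ = θ / h ≠ 0`, the semi-discretization is
`(U, V)' = -(1/h) M(θ) (U, V)`. The entries are read off at the cell `j = 0`. -/
noncomputable def symbolMatrix (l r : ℕ) (h θ : ℝ) : Matrix (Fin 2) (Fin 2) ℂ :=
  let e : ℤ → ℂ := fourierMode θ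
  let iκ : ℂ := Complex.I * ((θ / h : ℝ) : ℂ)
  (-(h : ℂ)) •
    !![rhsU l r h e 0 0, rhsU l r h 0 (iκ • e) 0;
       rhsV l r h e 0 0 / iκ, rhsV l r h 0 (iκ • e) 0 / iκ]

/-- The trace symbol, the trace of the von Neumann symbol. -/
noncomputable def traceSymbol (l r : ℕ) (h θ : ℝ) : ℂ := (symbolMatrix l r h θ).trace

/-- `μ` is an eigenvalue of the linear system of ordinary differential equations
`u_j' = rhsU`, `v_j' = rhsV` on the periodic grid with `N` cells. -/
def IsEigenvalueOnGrid (l r N : ℕ) (h : ℝ) (μ : ℂ) : Prop :=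
  ∃ u v : ℤ → ℂ,
    (∀ j, u (j + N) = u j) ∧ (∀ j, v (j + N) = v j) ∧ ¬(u = 0 ∧ v = 0) ∧
    ∀ j, rhsU l r h u v j = μ * u j ∧ rhsV l r h u v j = μ * v j

/-- Instability on the periodic grid with `N` cells of size `h`: the system has an eigenvalue with
positive real part, that is, an exponentially growing solution. -/
def IsUnstableOnGrid (l r N : ℕ) (h : ℝ) : Prop :=
  ∃ μ : ℂ, IsEigenvalueOnGrid l r N h μ ∧ 0 < μ.re

/-! Let m = l + r and let Q be a primitive of the reconstruction, in the coordinate whose nodes 0,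
…, m are the faces of the stencil. The cell averages prescribe the increments of Q and of Q' between
adjacent nodes, so the nodal values are known up to a constant a and the nodal derivatives up to a
constant c. Hermite data at m + 1 double nodes come from degree at most 2m exactly when one divided
difference vanishes (`hermite_functional_eq_zero`, `exists_hermite`). Its derivative weights are
proportional to the squared binomials, so c enters with a multiple of the nonzero `Nat.centralBinom
m` and is determined, while a drops out on passing to Q'. This gives unique solvability for every
stencil.

At θ = π the method acts on sawtooth data as a 2 × 2 matrix, and only the signs of its diagonal
entries are needed. For sawtooth u and v = 0, Q' equals c at every node, and the divided difference
expresses c through the alternating sum of harmonic numbers and squared binomials. That sum is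
evaluated by a telescoping certificate for the squared binomials, followed by summation by parts.

For u = 0 and sawtooth v, Q is the nodal polynomial W times R, where R has degree below m and
interpolates a multiple of the binomial coefficients. Then Q'' at a node needs only R and R' there.
The binomial recurrence holds for R up to a known multiple of a nodal polynomial; differentiated at
two nodes and combined with the symmetry of R, it yields R' at the node t + 3
(`interpolant_choose_derivative_at`).

Both diagonal entries of the evolution matrix turn out positive. Hence its trace is positive, and
one of its two eigenvalues has positive real part. The sawtooth lives on every periodic grid with an
even number of cells. -/

/-! ### Moments of alternating squared binomials -/

/-- Reflection `k ↦ m - k` of an alternating sum with squared binomial weights, `m` odd. -/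
lemma alternating_choose_sq_reflect {m : ℕ} (hm : Odd m) (f : ℕ → ℚ) :
    ∑ k ∈ Finset.range (m + 1), (-1 : ℚ) ^ k * (m.choose k : ℚ) ^ 2 * f k =
      -∑ k ∈ Finset.range (m + 1), (-1 : ℚ) ^ k * (m.choose k : ℚ) ^ 2 * f (m - k) := by
  rw [← Finset.sum_range_reflect, ← Finset.sum_neg_distrib]
  refine Finset.sum_congr rfl fun k hk => ?_
  have hk' : k ≤ m := by simpa [Nat.lt_succ_iff] using hk
  rw [show m + 1 - 1 - k = m - k by omega, Nat.choose_symm hk']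
  have h : (-1 : ℚ) ^ (m - k) = -(-1) ^ k := by
    have h1 : (-1 : ℚ) ^ (m - k) * (-1) ^ k = -1 := by
      rw [← pow_add, Nat.sub_add_cancel hk', hm.neg_one_pow]
    rcases neg_one_pow_eq_or ℚ k with h2 | h2 <;> rw [h2] at h1 ⊢ <;> linarith
  rw [h]; ring

lemma alternating_choose_sq_of_odd {m : ℕ} (hm : Odd m) :
    ∑ k ∈ Finset.range (m + 1), (-1 : ℚ) ^ k * (m.choose k : ℚ) ^ 2 = 0 := by
  have := alternating_choose_sq_reflect hm fun _ => 1
  simp only [mul_one] at this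
  linarith

lemma sum_range_shift {M : Type*} [AddCommGroup M] (f : ℕ → M) (n : ℕ) (h0 : f 0 = 0)
    (hn : f n = 0) : ∑ k ∈ Finset.range n, f (k + 1) = ∑ k ∈ Finset.range n, f k := by
  have h1 := Finset.sum_range_succ f n
  have h2 := Finset.sum_range_succ' f n
  rw [hn, add_zero] at h1
  rw [h0, add_zero] at h2
  rw [← h1, ← h2]

lemma choose_succ_mul_cast {m k : ℕ} (hk : k ≤ m) :
    (m.choose (k + 1) : ℚ) * (k + 1) = m.choose k * (m - k) := by
  rw [← Nat.cast_sub hk]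
  exact_mod_cast Nat.choose_succ_right_eq m k

lemma choose_add_two_mul_cast {m k : ℕ} (hk : k ≤ m + 2) :
    (m.choose k : ℚ) * ((m + 1) * (m + 2)) =
      (m + 2).choose k * ((m + 2 - k) * (m + 1 - k)) := by
  rcases Nat.lt_or_ge (m + 1) k with h | h
  · obtain rfl : k = m + 2 := by omega
    simp [Nat.choose_eq_zero_of_lt (show m < m + 2 by omega)]
  · have h1 := Nat.choose_mul_succ_eq m k
    have h2 := Nat.choose_mul_succ_eq (m + 1) k
    have h1' : (m.choose k : ℚ) * (m + 1) = (m + 1).choose k * (m + 1 - k) := by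
      have : ((m + 1 - k : ℕ) : ℚ) = m + 1 - k := by push_cast [Nat.cast_sub h]; ring
      rw [← this]; exact_mod_cast h1
    have h2' : ((m + 1).choose k : ℚ) * (m + 2) = (m + 2).choose k * (m + 2 - k) := by
      have : ((m + 1 + 1 - k : ℕ) : ℚ) = m + 2 - k := by push_cast [Nat.cast_sub hk]; ring
      rw [← this]; exact_mod_cast h2
    linear_combination (m + 2 : ℚ) * h1' + (m + 1 - k : ℚ) * h2'

/-- The cubic moment of the alternating squared binomials in terms of the first two. -/
lemma alternating_choose_sq_cubic_moment (m : ℕ) :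
    ∑ k ∈ Finset.range (m + 1), (-1 : ℚ) ^ k * (m.choose k : ℚ) ^ 2 *
      (2 * (k : ℚ) ^ 3 - (2 * m + 1) * (k : ℚ) ^ 2 + (m : ℚ) ^ 2 * k) = 0 := by
  -- Telescoping of `(-1)^k * choose^2 * (k-1) * k^2`: the factor `k^2` turns the shifted binomial
  -- into `choose^2 * (m-k)^2`.
  have h := sum_range_shift (fun k : ℕ => (-1 : ℚ) ^ k * (m.choose k : ℚ) ^ 2 *
      (((k : ℚ) - 1) * (k : ℚ) ^ 2)) (m + 1) (by simp) (by simp)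
  rw [← sub_eq_zero, ← Finset.sum_sub_distrib] at h
  rw [← neg_eq_zero, ← Finset.sum_neg_distrib, ← h]
  refine Finset.sum_congr rfl fun k hk => ?_
  have hk' : k ≤ m := by simpa [Nat.lt_succ_iff] using hk
  have h1 := choose_succ_mul_cast hk'
  have h2 : ((m.choose (k + 1) : ℚ)) ^ 2 * (k + 1) ^ 2 = (m.choose k) ^ 2 * (m - k) ^ 2 := by
    rw [← mul_pow, h1, mul_pow]
  push_cast
  rw [pow_succ (-1 : ℚ) k]
  linear_combination ((-1 : ℚ) ^ k * k) * h2

/-- The factor is `-k * (m - k)`, invariant under `k ↦ m - k`, while the signed weight is odd under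
it. -/
lemma alternating_choose_sq_quadratic_moment {m : ℕ} (hm : Odd m) :
    ∑ k ∈ Finset.range (m + 1), (-1 : ℚ) ^ k * (m.choose k : ℚ) ^ 2 *
      ((k : ℚ) ^ 2 - m * k) = 0 := by
  have h := alternating_choose_sq_reflect hm fun k => (k : ℚ) ^ 2 - m * k
  have h2 : ∑ k ∈ Finset.range (m + 1), (-1 : ℚ) ^ k * (m.choose k : ℚ) ^ 2 *
      (((m - k : ℕ) : ℚ) ^ 2 - m * ((m - k : ℕ) : ℚ)) =
      ∑ k ∈ Finset.range (m + 1), (-1 : ℚ) ^ k * (m.choose k : ℚ) ^ 2 *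
      ((k : ℚ) ^ 2 - m * k) := by
    refine Finset.sum_congr rfl fun k hk => ?_
    have hk' : k ≤ m := by simpa [Nat.lt_succ_iff] using hk
    rw [Nat.cast_sub hk']; ring
  rw [h2] at h
  linarith

/-! ### Telescoping certificate and the harmonic sum -/

/-- The factor of the telescoping certificate for the alternating sum of squared binomials. -/
def certFactor (m k : ℕ) : ℚ :=
  -(5 * m + 6) + (6 - 2 / (m + 1)) * ((k : ℚ) - 1) -
    (2 / (m + 1)) * (((k : ℚ) - 1) * ((k : ℚ) - 2))

/-- The telescoping certificate for the alternating sum of squared binomials. -/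
def cert (m k : ℕ) : ℚ :=
  (-1) ^ k * ((m + 2).choose k : ℚ) ^ 2 * ((k : ℚ) / (m + 2)) ^ 2 * certFactor m k

lemma cert_zero (m : ℕ) : cert m 0 = 0 := by simp [cert]

lemma cert_last (m : ℕ) : cert m (m + 3) = 0 := by simp [cert]

/-- Every binomial is a rational multiple of `(m + 2).choose k`; dividing by its square leaves an
identity of rational functions in `m` and `k`. -/
lemma cert_telescope {m k : ℕ} (hk : k ≤ m + 2) :
    (m + 2 : ℚ) * ((-1) ^ k * ((m + 2).choose k : ℚ) ^ 2) +
      4 * (m + 1) * ((-1) ^ k * (m.choose k : ℚ) ^ 2) = cert m (k + 1) - cert m k := by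
  have h1 := choose_succ_mul_cast hk
  have h2 := choose_add_two_mul_cast hk
  have hm1 : (m + 1 : ℚ) ≠ 0 := by positivity
  have hm2 : (m + 2 : ℚ) ≠ 0 := by positivity
  have e1 : (m.choose k : ℚ) =
      (m + 2).choose k * ((m + 2 - k) * (m + 1 - k)) / ((m + 1) * (m + 2)) := by
    field_simp; linear_combination h2
  have e2 : (((m + 2).choose (k + 1) : ℚ) * ((k + 1) / (m + 2))) ^ 2 =
      ((m + 2).choose k * (m + 2 - k) / (m + 2)) ^ 2 := by
    rw [← mul_div_assoc, h1]; push_cast; ring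
  have e3 : cert m (k + 1) =
      (-1) ^ (k + 1) * (((m + 2).choose (k + 1) : ℚ) * ((k + 1) / (m + 2))) ^ 2 *
        certFactor m (k + 1) := by
    rw [cert]; push_cast; ring
  rw [e3, e2, e1, cert, certFactor, certFactor, pow_succ]
  push_cast
  field_simp
  ring

/-- This is the correction term left by summation by parts. Division by the index cancels one
factor, leaving a cubic polynomial against the weights of `m + 2`; it is a combination of the
vanishing cubic and quadratic moments. Oddness enters through the latter. -/
lemma sum_cert_div {m : ℕ} (hm : Odd m) :
    ∑ k ∈ Finset.range (m + 3), cert m (k + 1) / (k + 1) = 0 := by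
  set g : ℕ → ℚ := fun k => (-1) ^ k * ((m + 2).choose k : ℚ) ^ 2 *
    ((k : ℚ) * certFactor m k / (m + 2) ^ 2) with hg
  have h1 : ∀ k : ℕ, cert m (k + 1) / (k + 1) = g (k + 1) := by
    intro k
    have : (k + 1 : ℚ) ≠ 0 := by positivity
    simp only [hg, cert]; push_cast; field_simp
  simp only [h1]
  rw [sum_range_shift g (m + 3) (by simp [hg]) (by simp [hg])]
  have hm1 : (m + 1 : ℚ) ≠ 0 := by positivity
  have hm2 : (m + 2 : ℚ) ≠ 0 := by positivity
  have c3 := alternating_choose_sq_cubic_moment (m + 2)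
  have c2 := alternating_choose_sq_quadratic_moment (m := m + 2) (by
    rcases hm with ⟨a, rfl⟩; exact ⟨a + 1, by ring⟩)
  have key : ∀ k : ℕ, g k =
      (-1 / ((m + 1) * (m + 2) ^ 2)) * ((-1 : ℚ) ^ k * ((m + 2).choose k : ℚ) ^ 2 *
        (2 * (k : ℚ) ^ 3 - (2 * (m + 2 : ℕ) + 1) * (k : ℚ) ^ 2 + ((m + 2 : ℕ) : ℚ) ^ 2 * k)) +
      ((4 * m + 5) / ((m + 1) * (m + 2) ^ 2)) * ((-1 : ℚ) ^ k * ((m + 2).choose k : ℚ) ^ 2 *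
        ((k : ℚ) ^ 2 - (m + 2 : ℕ) * k)) := by
    intro k
    simp only [hg, certFactor]
    push_cast
    field_simp
    ring
  simp only [key]
  rw [Finset.sum_add_distrib, ← Finset.mul_sum, ← Finset.mul_sum, c3, c2]
  simp

lemma sum_range_choose_eq_zero_of_lt {m M : ℕ} (hM : m + 1 ≤ M) (f : ℕ → ℚ) :
    ∑ k ∈ Finset.range M, (-1 : ℚ) ^ k * (m.choose k : ℚ) ^ 2 * f k =
      ∑ k ∈ Finset.range (m + 1), (-1 : ℚ) ^ k * (m.choose k : ℚ) ^ 2 * f k := by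
  symm
  refine Finset.sum_subset (Finset.range_subset_range.2 hM) fun k _ hk => ?_
  rw [Nat.choose_eq_zero_of_lt (by simpa using hk)]
  simp

lemma alternating_choose_sq_recurrence (m : ℕ) :
    (m + 2 : ℚ) * ∑ k ∈ Finset.range (m + 2 + 1), (-1 : ℚ) ^ k * ((m + 2).choose k : ℚ) ^ 2 +
      4 * (m + 1) * ∑ k ∈ Finset.range (m + 1), (-1 : ℚ) ^ k * (m.choose k : ℚ) ^ 2 = 0 := by
  have h := sum_range_choose_eq_zero_of_lt (show m + 1 ≤ m + 3 by omega) fun _ => 1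
  simp only [mul_one] at h
  rw [← h, Finset.mul_sum, Finset.mul_sum, ← Finset.sum_add_distrib]
  rw [Finset.sum_congr rfl fun k hk =>
    cert_telescope (m := m) (k := k) (by have := Finset.mem_range.1 hk; omega),
    Finset.sum_range_sub, cert_last, cert_zero, sub_zero]

lemma alternating_choose_sq_even (n : ℕ) :
    ∑ k ∈ Finset.range (2 * n + 1), (-1 : ℚ) ^ k * ((2 * n).choose k : ℚ) ^ 2 =
      (-1) ^ n * ((2 * n).factorial : ℚ) / (n.factorial : ℚ) ^ 2 := by
  induction n with
  | zero => simp
  | succ n ih =>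
    have h := alternating_choose_sq_recurrence (2 * n)
    rw [ih] at h
    rw [show 2 * (n + 1) = 2 * n + 2 by ring]
    have hn : ((2 * n : ℕ) + 2 : ℚ) ≠ 0 := by positivity
    have hf : (n.factorial : ℚ) ≠ 0 := by positivity
    refine mul_left_cancel₀ hn ?_
    rw [eq_neg_of_add_eq_zero_left h, Nat.factorial_succ (2 * n + 1), Nat.factorial_succ (2 * n),
      Nat.factorial_succ n]
    push_cast
    rw [pow_succ]
    field_simp
    ring

/-- Abel summation, with `1 / (k + 1)` as the increment of the harmonic numbers. -/
lemma sum_harmonic_mul_sub (f : ℕ → ℚ) (n : ℕ) :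
    ∑ k ∈ Finset.range n, harmonic k * (f (k + 1) - f k) =
      harmonic n * f n - ∑ k ∈ Finset.range n, f (k + 1) / (k + 1) := by
  induction n with
  | zero => simp
  | succ n ih =>
    rw [Finset.sum_range_succ, Finset.sum_range_succ, ih, harmonic_succ]
    push_cast
    field_simp
    ring

/-- The certificate, weighted by `harmonic`, still telescopes up to the Abel correction, which
`sum_cert_div` kills; hence the same recurrence as without harmonic numbers. -/
lemma alternating_harmonic_choose_sq_recurrence {m : ℕ} (hm : Odd m) :
    (m + 2 : ℚ) * ∑ k ∈ Finset.range (m + 2 + 1),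
        (-1 : ℚ) ^ k * ((m + 2).choose k : ℚ) ^ 2 * harmonic k +
      4 * (m + 1) * ∑ k ∈ Finset.range (m + 1),
        (-1 : ℚ) ^ k * (m.choose k : ℚ) ^ 2 * harmonic k = 0 := by
  rw [← sum_range_choose_eq_zero_of_lt (show m + 1 ≤ m + 3 by omega) harmonic,
    Finset.mul_sum, Finset.mul_sum, ← Finset.sum_add_distrib]
  have h := sum_harmonic_mul_sub (cert m) (m + 3)
  rw [cert_last, sum_cert_div hm] at h
  rw [mul_zero, sub_zero] at h
  rw [← h]
  refine Finset.sum_congr rfl fun k hk => ?_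
  rw [← cert_telescope (m := m) (k := k) (by have := Finset.mem_range.1 hk; omega)]
  ring

lemma alternating_harmonic_choose_sq (n : ℕ) :
    ∑ k ∈ Finset.range (2 * n + 2),
        (-1 : ℚ) ^ k * harmonic k * ((2 * n + 1).choose k : ℚ) ^ 2 =
      (-1 : ℚ) ^ (n + 1) * 2 ^ (4 * n) * (n.factorial : ℚ) ^ 2 / ((2 * n + 1).factorial : ℚ) := by
  simp only [mul_right_comm _ (harmonic _)]
  induction n with
  | zero => simp [Finset.sum_range_succ]
  | succ n ih =>
    have h := alternating_harmonic_choose_sq_recurrence (m := 2 * n + 1) ⟨n, rfl⟩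
    rw [ih] at h
    rw [show 2 * (n + 1) + 2 = 2 * n + 1 + 2 + 1 by ring,
      show 2 * (n + 1) + 1 = 2 * n + 1 + 2 by ring]
    have hn : ((2 * n + 1 : ℕ) + 2 : ℚ) ≠ 0 := by positivity
    refine mul_left_cancel₀ hn ?_
    rw [eq_neg_of_add_eq_zero_left h, Nat.factorial_succ (2 * n + 1 + 1),
      Nat.factorial_succ (2 * n + 1), Nat.factorial_succ n]
    have hf : ((2 * n + 1).factorial : ℚ) ≠ 0 := by positivity
    push_cast
    rw [pow_succ (-1 : ℚ) (n + 1), show 4 * (n + 1) = 4 * n + 4 by ring, pow_add (2 : ℚ) (4 * n) 4]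
    field_simp
    ring

/-- Absorbing `k` into one binomial and applying Pascal's rule to the other reduces this to the even
alternating sum plus cross terms that cancel. -/
lemma alternating_choose_sq_linear_moment (n : ℕ) :
    ∑ k ∈ Finset.range (2 * n + 2), (-1 : ℚ) ^ k * ((2 * n + 1).choose k : ℚ) ^ 2 * k =
      (-1) ^ (n + 1) * ((2 * n + 1).factorial : ℚ) / (n.factorial : ℚ) ^ 2 := by
  have e := alternating_choose_sq_even n
  -- The cross terms change sign under `k ↦ 2n - 1 - k`.
  have hr : ∑ k ∈ Finset.range (2 * n + 1), (-1 : ℚ) ^ k *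
      ((2 * n).choose k * (2 * n).choose (k + 1) : ℚ) = 0 := by
    rw [Finset.sum_range_succ]
    simp only [Nat.choose_succ_self, Nat.cast_zero, mul_zero, add_zero]
    have h : ∑ k ∈ Finset.range (2 * n), (-1 : ℚ) ^ k *
        ((2 * n).choose k * (2 * n).choose (k + 1) : ℚ) =
        -∑ k ∈ Finset.range (2 * n), (-1 : ℚ) ^ k *
        ((2 * n).choose k * (2 * n).choose (k + 1) : ℚ) := by
      conv_lhs => rw [← Finset.sum_range_reflect]
      rw [← Finset.sum_neg_distrib]
      refine Finset.sum_congr rfl fun k hk => ?_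
      have hk' : k < 2 * n := by simpa using hk
      have h1 : (2 * n).choose (2 * n - 1 - k) = (2 * n).choose (k + 1) := by
        rw [← Nat.choose_symm (show k + 1 ≤ 2 * n by omega)]; congr 1; omega
      have h2 : (2 * n).choose (2 * n - 1 - k + 1) = (2 * n).choose k := by
        rw [← Nat.choose_symm (show k ≤ 2 * n by omega)]; congr 1; omega
      have h3 : (-1 : ℚ) ^ (2 * n - 1 - k) = -(-1) ^ k := by
        have : (-1 : ℚ) ^ (2 * n - 1 - k) * (-1) ^ k = -1 := by
          rw [← pow_add, show 2 * n - 1 - k + k = 2 * (n - 1) + 1 by omega, pow_succ, pow_mul]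
          simp
        rcases neg_one_pow_eq_or ℚ k with h2 | h2 <;> rw [h2] at this ⊢ <;> linarith
      rw [h1, h2, h3]; ring
    linarith
  rw [Finset.sum_range_succ']
  simp only [Nat.cast_zero, mul_zero, add_zero]
  have key : ∀ k : ℕ, (-1 : ℚ) ^ (k + 1) * ((2 * n + 1).choose (k + 1) : ℚ) ^ 2 * (k + 1 : ℕ) =
      -(2 * n + 1) * ((-1 : ℚ) ^ k * ((2 * n).choose k : ℚ) ^ 2) -
      (2 * n + 1) * ((-1 : ℚ) ^ k * ((2 * n).choose k * (2 * n).choose (k + 1) : ℚ)) := by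
    intro k
    have h1 : ((2 * n + 1 : ℚ)) * (2 * n).choose k = (2 * n + 1).choose (k + 1) * (k + 1) := by
      exact_mod_cast Nat.add_one_mul_choose_eq (2 * n) k
    have h2 : ((2 * n + 1).choose (k + 1) : ℚ) = (2 * n).choose k + (2 * n).choose (k + 1) := by
      exact_mod_cast Nat.choose_succ_succ (2 * n) k
    rw [pow_succ]
    push_cast
    linear_combination ((-1 : ℚ) ^ k * (2 * n + 1).choose (k + 1)) * h1 -
      ((-1 : ℚ) ^ k * (2 * n + 1) * (2 * n).choose k) * h2
  simp only [key]
  rw [Finset.sum_sub_distrib, ← Finset.mul_sum, ← Finset.mul_sum, hr, e, Nat.factorial_succ]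
  push_cast
  rw [pow_succ]
  ring

/-! ### Nodal polynomials on the integer grid -/

/-- The product of the differences of `i` with the other nodes `0, …, m`. -/
noncomputable def gridWeight (m i : ℕ) : ℂ :=
  ∏ j ∈ (Finset.range (m + 1)).erase i, ((i : ℂ) - j)

/-- The sum of the inverse differences of `i` with the other nodes `0, …, m`. -/
noncomputable def gridLogDeriv (m i : ℕ) : ℂ := ((harmonic i - harmonic (m - i) : ℚ) : ℂ)

lemma erase_range_eq {m i : ℕ} (hi : i ≤ m) :
    (Finset.range (m + 1)).erase i = Finset.range i ∪ Finset.Ico (i + 1) (m + 1) := by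
  ext j; simp; omega

lemma disjoint_range_Ico_succ (m i : ℕ) :
    Disjoint (Finset.range i) (Finset.Ico (i + 1) (m + 1)) := by
  rw [Finset.disjoint_left]; intro j; simp; omega

lemma prod_range_sub_cast (i : ℕ) : ∏ j ∈ Finset.range i, ((i : ℂ) - j) = i.factorial := by
  rw [← Finset.prod_range_reflect, Nat.factorial_eq_prod_range_add_one]
  push_cast
  refine Finset.prod_congr rfl fun j hj => ?_
  have : j < i := by simpa using hj
  rw [show i - 1 - j = i - (j + 1) by omega, Nat.cast_sub (by omega)]
  push_cast; ring

lemma gridWeight_eq {m i : ℕ} (hi : i ≤ m) :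
    gridWeight m i = (-1) ^ (m - i) * (i.factorial * (m - i).factorial : ℂ) := by
  rw [gridWeight, erase_range_eq hi, Finset.prod_union (disjoint_range_Ico_succ m i),
    prod_range_sub_cast, Finset.prod_Ico_eq_prod_range, Nat.add_sub_add_right,
    Nat.factorial_eq_prod_range_add_one (m - i)]
  have : ∀ k ∈ Finset.range (m - i), ((i : ℂ) - ((i + 1 + k : ℕ) : ℂ)) = -1 * ((k + 1 : ℕ) : ℂ) := by
    intro k _; push_cast; ring
  rw [Finset.prod_congr rfl this, Finset.prod_mul_distrib, Finset.prod_const, Finset.card_range,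
    Nat.cast_prod]
  ring

lemma gridWeight_ne_zero {m i : ℕ} (hi : i ≤ m) : gridWeight m i ≠ 0 := by
  rw [gridWeight_eq hi]
  exact mul_ne_zero (pow_ne_zero _ (by norm_num))
    (mul_ne_zero (by exact_mod_cast i.factorial_ne_zero) (by exact_mod_cast (m - i).factorial_ne_zero))

lemma gridWeight_mul_choose {m i : ℕ} (hi : i ≤ m) :
    gridWeight m i * m.choose i = (-1) ^ (m - i) * (m.factorial : ℂ) := by
  rw [gridWeight_eq hi, ← Nat.choose_mul_factorial_mul_factorial hi]
  push_cast; ring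

lemma inv_gridWeight {m i : ℕ} (hi : i ≤ m) :
    (gridWeight m i)⁻¹ = (-1) ^ (m - i) * m.choose i / (m.factorial : ℂ) := by
  have hm : (m.factorial : ℂ) ≠ 0 := by exact_mod_cast m.factorial_ne_zero
  have h := gridWeight_mul_choose hi
  have h0 := gridWeight_ne_zero hi
  have h1 : ((-1 : ℂ) ^ (m - i)) * (-1) ^ (m - i) = 1 := by rw [← mul_pow]; simp
  field_simp
  linear_combination (-(-1 : ℂ) ^ (m - i)) * h - (m.factorial : ℂ) * h1

/-- Squaring removes the signs; this is why the Hermite functional carries squared binomials. -/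
lemma inv_gridWeight_sq {m i : ℕ} (hi : i ≤ m) :
    ((gridWeight m i) ^ 2)⁻¹ = (m.choose i : ℂ) ^ 2 / (m.factorial : ℂ) ^ 2 := by
  have h1 : ((-1 : ℂ) ^ (m - i)) ^ 2 = 1 := by rw [← pow_mul, mul_comm, pow_mul]; simp
  rw [← inv_pow, inv_gridWeight hi, div_pow, mul_pow, h1, one_mul]

lemma harmonic_cast (n : ℕ) :
    ((harmonic n : ℚ) : ℂ) = ∑ k ∈ Finset.range n, ((k + 1 : ℕ) : ℂ)⁻¹ := by
  simp [harmonic]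

lemma sum_inv_sub_eq_gridLogDeriv {m i : ℕ} (hi : i ≤ m) :
    ∑ j ∈ (Finset.range (m + 1)).erase i, ((i : ℂ) - j)⁻¹ = gridLogDeriv m i := by
  rw [gridLogDeriv, Rat.cast_sub, harmonic_cast, harmonic_cast, erase_range_eq hi,
    Finset.sum_union (disjoint_range_Ico_succ m i), Finset.sum_Ico_eq_sum_range,
    Nat.add_sub_add_right, sub_eq_add_neg, ← Finset.sum_neg_distrib]
  congr 1
  · rw [← Finset.sum_range_reflect]
    refine Finset.sum_congr rfl fun j hj => ?_
    have : j < i := by simpa using hj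
    rw [show i - 1 - j = i - (j + 1) by omega, Nat.cast_sub (by omega)]
    push_cast; ring
  · refine Finset.sum_congr rfl fun k _ => ?_
    rw [← inv_neg]; push_cast; ring

/-- The polynomial with simple zeros at the nodes `0, …, m`. -/
noncomputable abbrev gridNodal (m : ℕ) : ℂ[X] :=
  Lagrange.nodal (Finset.range (m + 1)) (fun j : ℕ => (j : ℂ))

/-- The polynomial with simple zeros at the nodes `0, …, m` other than `i`. -/
noncomputable abbrev gridNodalErase (m i : ℕ) : ℂ[X] :=
  Lagrange.nodal ((Finset.range (m + 1)).erase i) (fun j : ℕ => (j : ℂ))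

lemma injOn_natCast (s : Set ℕ) : Set.InjOn (fun j : ℕ => (j : ℂ)) s :=
  Nat.cast_injective.injOn

lemma eval_gridNodalErase_self (m i : ℕ) :
    (gridNodalErase m i).eval (i : ℂ) = gridWeight m i := by
  rw [Lagrange.eval_nodal, gridWeight]

lemma eval_gridNodalErase_of_ne {m i j : ℕ} (hj : j ≤ m) (hij : j ≠ i) :
    (gridNodalErase m i).eval (j : ℂ) = 0 :=
  Lagrange.eval_nodal_at_node (v := fun j : ℕ => (j : ℂ)) (by simp; omega)

lemma eval_gridNodal {m i : ℕ} (hi : i ≤ m) : (gridNodal m).eval (i : ℂ) = 0 :=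
  Lagrange.eval_nodal_at_node (v := fun j : ℕ => (j : ℂ)) (by simp; omega)

lemma gridNodal_eq_mul {m i : ℕ} (hi : i ≤ m) :
    gridNodal m = (X - C (i : ℂ)) * gridNodalErase m i :=
  Lagrange.nodal_eq_mul_nodal_erase (v := fun j : ℕ => (j : ℂ)) (by simp; omega)

lemma eval_derivative_gridNodal {m i : ℕ} (hi : i ≤ m) :
    (derivative (gridNodal m)).eval (i : ℂ) = gridWeight m i := by
  rw [gridNodal_eq_mul hi]
  simp [derivative_mul, eval_gridNodalErase_self]

lemma eval_derivative_nodal_of_ne (s : Finset ℕ) (v : ℕ → ℂ) (x : ℂ) (hx : ∀ j ∈ s, x ≠ v j) :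
    (derivative (Lagrange.nodal s v)).eval x =
      (Lagrange.nodal s v).eval x * ∑ j ∈ s, (x - v j)⁻¹ := by
  induction s using Finset.induction_on with
  | empty => simp
  | insert a s ha ih =>
    rw [Lagrange.nodal_insert_eq_nodal ha, derivative_mul, Finset.sum_insert ha, eval_add,
      eval_mul, eval_mul, ih fun j hj => hx j (Finset.mem_insert_of_mem hj)]
    have : x - v a ≠ 0 := sub_ne_zero.2 (hx a (Finset.mem_insert_self _ _))
    simp
    field_simp

lemma eval_derivative_gridNodalErase_self {m i : ℕ} (hi : i ≤ m) :
    (derivative (gridNodalErase m i)).eval (i : ℂ) = gridWeight m i * gridLogDeriv m i := by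
  rw [eval_derivative_nodal_of_ne _ _ _ ?_, eval_gridNodalErase_self,
    sum_inv_sub_eq_gridLogDeriv hi]
  intro j hj h
  exact (Finset.mem_erase.1 hj).1 (Nat.cast_injective h).symm

lemma degree_gridNodal (m : ℕ) : (gridNodal m).degree = ((m + 1 : ℕ) : WithBot ℕ) := by
  rw [Lagrange.degree_nodal, Finset.card_range]

lemma degree_gridNodalErase {m i : ℕ} (hi : i ≤ m) :
    (gridNodalErase m i).degree = (m : WithBot ℕ) := by
  rw [Lagrange.degree_nodal, Finset.card_erase_of_mem (by simp; omega), Finset.card_range]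
  simp

/-- A polynomial vanishing at the nodes is a multiple of the nodal polynomial. -/
lemma exists_eq_gridNodal_mul {m : ℕ} (Q : ℂ[X]) (hQ : Q.degree < ((2 * m + 1 : ℕ) : WithBot ℕ))
    (h0 : ∀ i ≤ m, Q.eval (i : ℂ) = 0) :
    ∃ R : ℂ[X], R.degree < (m : WithBot ℕ) ∧ Q = gridNodal m * R := by
  have hdvd : gridNodal m ∣ Q := by
    refine Finset.prod_dvd_of_coprime ?_ fun i hi => ?_
    · intro a _ b _ hab
      exact pairwise_coprime_X_sub_C (Nat.cast_injective (R := ℂ)) hab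
    · rw [dvd_iff_isRoot]; exact h0 i (by simpa [Nat.lt_succ_iff] using hi)
  obtain ⟨R, rfl⟩ := hdvd
  refine ⟨R, ?_, rfl⟩
  rcases eq_or_ne R 0 with rfl | hR
  · simp
  · rw [degree_mul, degree_gridNodal, degree_eq_natDegree hR, ← Nat.cast_add, Nat.cast_lt] at hQ
    rw [degree_eq_natDegree hR, Nat.cast_lt]
    omega

lemma eval_derivative_gridNodal_mul {m i : ℕ} (hi : i ≤ m) (R : ℂ[X]) :
    (derivative (gridNodal m * R)).eval (i : ℂ) = gridWeight m i * R.eval (i : ℂ) := by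
  rw [derivative_mul, eval_add, eval_mul, eval_mul, eval_gridNodal hi,
    eval_derivative_gridNodal hi]
  ring

/-- The top coefficient of a polynomial of degree at most `m` from its values at the nodes. -/
lemma coeff_eq_sum_grid {m : ℕ} (P : ℂ[X]) (hP : P.degree < ((m + 1 : ℕ) : WithBot ℕ)) :
    P.coeff m = ∑ i ∈ Finset.range (m + 1), P.eval (i : ℂ) / gridWeight m i := by
  have := Lagrange.coeff_eq_sum (s := Finset.range (m + 1)) (injOn_natCast _) (P := P)
    (by simpa using hP)
  simpa [gridWeight] using this

lemma degree_lt_of_coeff_eq_zero {m : ℕ} (P : ℂ[X]) (hP : P.degree < ((m + 1 : ℕ) : WithBot ℕ))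
    (h : P.coeff m = 0) : P.degree < (m : WithBot ℕ) := by
  rw [degree_lt_iff_coeff_zero] at hP ⊢
  intro k hk
  rcases hk.eq_or_lt with rfl | hk
  · exact h
  · exact hP k hk

/-! ### Hermite interpolation with one degree less -/

/-- The part of the Hermite interpolant that carries the values `a i` at the nodes. -/
noncomputable def hermiteValuePart (m : ℕ) (a : ℕ → ℂ) : ℂ[X] :=
  ∑ i ∈ Finset.range (m + 1), C (a i / gridWeight m i ^ 2) * gridNodalErase m i ^ 2

lemma degree_hermiteValuePart (m : ℕ) (a : ℕ → ℂ) :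
    (hermiteValuePart m a).degree < ((2 * m + 1 : ℕ) : WithBot ℕ) := by
  refine lt_of_le_of_lt (b := ((2 * m : ℕ) : WithBot ℕ)) ?_ (by norm_cast; omega)
  refine (degree_sum_le _ _).trans (Finset.sup_le fun i hi => ?_)
  rw [← smul_eq_C_mul]
  refine (degree_smul_le _ _).trans ?_
  rw [degree_pow, degree_gridNodalErase (by simpa [Nat.lt_succ_iff] using hi)]
  simp

lemma eval_hermiteValuePart {m i : ℕ} (hi : i ≤ m) (a : ℕ → ℂ) :
    (hermiteValuePart m a).eval (i : ℂ) = a i := by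
  rw [hermiteValuePart, eval_finsetSum, Finset.sum_eq_single i]
  · rw [eval_mul, eval_C, eval_pow, eval_gridNodalErase_self]
    have := gridWeight_ne_zero hi
    field_simp
  · intro j _ hj
    simp [eval_gridNodalErase_of_ne hi hj.symm]
  · intro h; simp at h; omega

/-- The other summands have a double zero at `i`; squaring doubles the logarithmic derivative of the
remaining one. -/
lemma eval_derivative_hermiteValuePart {m i : ℕ} (hi : i ≤ m) (a : ℕ → ℂ) :
    (derivative (hermiteValuePart m a)).eval (i : ℂ) = 2 * a i * gridLogDeriv m i := by
  rw [hermiteValuePart, derivative_sum, eval_finsetSum, Finset.sum_eq_single i]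
  · rw [derivative_C_mul, derivative_pow, eval_mul, eval_C, eval_mul, eval_mul, eval_pow,
      eval_gridNodalErase_self, eval_derivative_gridNodalErase_self hi]
    have := gridWeight_ne_zero hi
    simp
    field_simp
  · intro j _ hj
    simp [derivative_pow, eval_gridNodalErase_of_ne hi hj.symm]
  · intro h; simp at h; omega

lemma sum_div_gridWeight_sq (m : ℕ) (f : ℕ → ℂ) :
    ∑ i ∈ Finset.range (m + 1), f i / gridWeight m i ^ 2 =
      (∑ i ∈ Finset.range (m + 1), (m.choose i : ℂ) ^ 2 * f i) / (m.factorial : ℂ) ^ 2 := by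
  rw [Finset.sum_div]
  refine Finset.sum_congr rfl fun i hi => ?_
  rw [div_eq_mul_inv, inv_gridWeight_sq (by simpa [Nat.lt_succ_iff] using hi)]
  ring

/-- The divided difference over the doubled nodes vanishes in degree at most `2m`. -/
lemma hermite_functional_eq_zero {m : ℕ} (Q : ℂ[X])
    (hQ : Q.degree < ((2 * m + 1 : ℕ) : WithBot ℕ)) :
    ∑ i ∈ Finset.range (m + 1), (m.choose i : ℂ) ^ 2 *
      ((derivative Q).eval (i : ℂ) - 2 * Q.eval (i : ℂ) * gridLogDeriv m i) = 0 := by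
  -- `Q - L` vanishes at the nodes, so it is the nodal polynomial times some `R` of degree below
  -- `m`. The vanishing coefficient of `R` at `m`, written through its `m + 1` nodal values, is the
  -- claim.
  set L := hermiteValuePart m fun i => Q.eval (i : ℂ) with hL
  obtain ⟨R, hR, hQR⟩ := exists_eq_gridNodal_mul (Q - L)
    ((degree_sub_le _ _).trans_lt (max_lt hQ (degree_hermiteValuePart _ _)))
    (fun i hi => by simp [hL, eval_hermiteValuePart hi])
  have h1 := coeff_eq_sum_grid (m := m) R (hR.trans (by norm_cast; omega))
  rw [coeff_eq_zero_of_degree_lt hR] at h1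
  have h2 : ∀ i ∈ Finset.range (m + 1), R.eval (i : ℂ) / gridWeight m i =
      ((derivative Q).eval (i : ℂ) - 2 * Q.eval (i : ℂ) * gridLogDeriv m i) /
        gridWeight m i ^ 2 := by
    intro i hi
    have hi' : i ≤ m := by simpa [Nat.lt_succ_iff] using hi
    have h3 := congrArg (fun P => (derivative P).eval (i : ℂ)) hQR
    simp only [eval_derivative_gridNodal_mul hi', derivative_sub, eval_sub, hL,
      eval_derivative_hermiteValuePart hi'] at h3
    have := gridWeight_ne_zero hi'
    rw [h3]
    field_simp
  rw [Finset.sum_congr rfl h2, sum_div_gridWeight_sq] at h1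
  have hm : (m.factorial : ℂ) ^ 2 ≠ 0 := by exact_mod_cast pow_ne_zero 2 m.factorial_ne_zero
  exact (div_eq_zero_iff.1 h1.symm).resolve_right hm

/-- Converse of `hermite_functional_eq_zero`: the functional is the top coefficient, up to a nonzero
factor, of the cofactor of the nodal polynomial, so its vanishing lowers the degree by one. -/
lemma exists_hermite {m : ℕ} (a d : ℕ → ℂ)
    (h : ∑ i ∈ Finset.range (m + 1), (m.choose i : ℂ) ^ 2 *
      (d i - 2 * a i * gridLogDeriv m i) = 0) :
    ∃ Q : ℂ[X], Q.degree < ((2 * m + 1 : ℕ) : WithBot ℕ) ∧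
      ∀ i ≤ m, Q.eval (i : ℂ) = a i ∧ (derivative Q).eval (i : ℂ) = d i := by
  set r : ℕ → ℂ := fun i => (d i - 2 * a i * gridLogDeriv m i) / gridWeight m i with hr
  set R := Lagrange.interpolate (Finset.range (m + 1)) (fun j : ℕ => (j : ℂ)) r with hRdef
  have hev : ∀ i ≤ m, R.eval (i : ℂ) = r i := fun i hi =>
    Lagrange.eval_interpolate_at_node (v := fun j : ℕ => (j : ℂ)) r (injOn_natCast _)
      (by simp; omega)
  have hdeg : R.degree < ((m + 1 : ℕ) : WithBot ℕ) := by
    have := Lagrange.degree_interpolate_lt r (injOn_natCast (Finset.range (m + 1) : Set ℕ))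
    rwa [Finset.card_range] at this
  have hcoeff : R.coeff m = 0 := by
    rw [coeff_eq_sum_grid R hdeg]
    have : ∀ i ∈ Finset.range (m + 1), R.eval (i : ℂ) / gridWeight m i =
        (d i - 2 * a i * gridLogDeriv m i) / gridWeight m i ^ 2 := by
      intro i hi
      rw [hev i (by simpa [Nat.lt_succ_iff] using hi), hr]
      rw [div_div, pow_two]
    rw [Finset.sum_congr rfl this, sum_div_gridWeight_sq, h, zero_div]
  have hdeg' := degree_lt_of_coeff_eq_zero R hdeg hcoeff
  refine ⟨hermiteValuePart m a + gridNodal m * R, ?_, fun i hi => ⟨?_, ?_⟩⟩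
  · refine (degree_add_le _ _).trans_lt (max_lt (degree_hermiteValuePart _ _) ?_)
    rcases eq_or_ne R 0 with hR | hR
    · rw [hR, mul_zero, degree_zero]; exact WithBot.bot_lt_coe _
    · rw [degree_eq_natDegree hR, Nat.cast_lt] at hdeg'
      rw [degree_mul, degree_gridNodal, degree_eq_natDegree hR, ← Nat.cast_add, Nat.cast_lt]
      omega
  · simp [eval_hermiteValuePart hi, eval_gridNodal hi]
  · rw [derivative_add, eval_add, eval_derivative_hermiteValuePart hi,
      eval_derivative_gridNodal_mul hi, hev i hi, hr]
    have := gridWeight_ne_zero hi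
    field_simp
    ring

lemma sum_choose_sq_cast (m : ℕ) :
    ∑ i ∈ Finset.range (m + 1), (m.choose i : ℂ) ^ 2 = (Nat.centralBinom m : ℂ) := by
  rw [Nat.centralBinom, ← Nat.sum_range_choose_sq]; push_cast; rfl

lemma centralBinom_cast_ne_zero (m : ℕ) : (Nat.centralBinom m : ℂ) ≠ 0 :=
  by exact_mod_cast Nat.centralBinom_ne_zero m

/-- Existence for the reconstruction problem on the unit grid. -/
lemma exists_hermite_differences (m : ℕ) (U V : ℕ → ℂ) :
    ∃ Q : ℂ[X], Q.degree < ((2 * m + 1 : ℕ) : WithBot ℕ) ∧ ∀ i < m,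
      Q.eval ((i : ℂ) + 1) - Q.eval (i : ℂ) = U i ∧
      (derivative Q).eval ((i : ℂ) + 1) - (derivative Q).eval (i : ℂ) = V i := by
  set a : ℕ → ℂ := fun i => ∑ k ∈ Finset.range i, U k with ha
  set d : ℕ → ℂ := fun i => ∑ k ∈ Finset.range i, V k with hd
  -- The free constant in the nodal derivatives, chosen to make the functional vanish; the total
  -- weight is the central binomial coefficient.
  set c : ℂ := -(∑ i ∈ Finset.range (m + 1), (m.choose i : ℂ) ^ 2 *
      (d i - 2 * a i * gridLogDeriv m i)) / Nat.centralBinom m with hc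
  obtain ⟨Q, hQ, h⟩ := exists_hermite (m := m) a (fun i => d i + c) (by
    have : ∀ i, (m.choose i : ℂ) ^ 2 * (d i + c - 2 * a i * gridLogDeriv m i) =
      (m.choose i : ℂ) ^ 2 * (d i - 2 * a i * gridLogDeriv m i) + (m.choose i : ℂ) ^ 2 * c :=
      fun i => by ring
    rw [Finset.sum_congr rfl fun i _ => this i, Finset.sum_add_distrib, ← Finset.sum_mul,
      sum_choose_sq_cast, hc, mul_div_cancel₀ _ (centralBinom_cast_ne_zero m)]
    ring)
  refine ⟨Q, hQ, fun i hi => ?_⟩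
  have h1 := h i hi.le
  have h2 := h (i + 1) hi
  push_cast at h2
  rw [h1.1, h1.2, h2.1, h2.2]
  simp [ha, hd, Finset.sum_range_succ]

/-- Uniqueness, up to constants, for the reconstruction problem on the unit grid. -/
lemma eq_C_of_hermite_differences {m : ℕ} (Q : ℂ[X])
    (hQ : Q.degree < ((2 * m + 1 : ℕ) : WithBot ℕ))
    (h : ∀ i < m, Q.eval ((i : ℂ) + 1) - Q.eval (i : ℂ) = 0 ∧
      (derivative Q).eval ((i : ℂ) + 1) - (derivative Q).eval (i : ℂ) = 0) :
    ∃ a : ℂ, Q = C a := by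
  have hval : ∀ i ≤ m, Q.eval (i : ℂ) = Q.eval 0 ∧
      (derivative Q).eval (i : ℂ) = (derivative Q).eval 0 := by
    intro i
    induction i with
    | zero => simp
    | succ i ih =>
      intro hi
      have h1 := ih (by omega)
      have h2 := h i hi
      push_cast
      rw [← h1.1, ← h1.2]
      exact ⟨sub_eq_zero.1 h2.1, sub_eq_zero.1 h2.2⟩
  refine ⟨Q.eval 0, ?_⟩
  set T := Q - C (Q.eval 0) with hT
  have hTdeg : T.degree < ((2 * m + 1 : ℕ) : WithBot ℕ) :=
    (degree_sub_le _ _).trans_lt (max_lt hQ (degree_C_le.trans_lt (by norm_cast; omega)))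
  have hT0 : ∀ i ≤ m, T.eval (i : ℂ) = 0 := fun i hi => by simp [hT, (hval i hi).1]
  have hT1 : ∀ i ≤ m, (derivative T).eval (i : ℂ) = (derivative Q).eval 0 := fun i hi => by
    simp [hT, (hval i hi).2]
  have hf := hermite_functional_eq_zero T hTdeg
  -- With zero nodal values and a constant nodal derivative, the functional is that constant times a
  -- nonzero total weight.
  have hc : (derivative Q).eval 0 = 0 := by
    rw [Finset.sum_congr rfl fun i hi => by
      rw [hT0 i (by simpa [Nat.lt_succ_iff] using hi), hT1 i (by simpa [Nat.lt_succ_iff] using hi),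
        mul_zero, zero_mul, sub_zero], ← Finset.sum_mul, sum_choose_sq_cast] at hf
    exact (mul_eq_zero.1 hf).resolve_left (centralBinom_cast_ne_zero m)
  obtain ⟨R, hR, hTR⟩ := exists_eq_gridNodal_mul T hTdeg hT0
  have hR0 : R = 0 := by
    refine Polynomial.eq_zero_of_degree_lt_of_eval_index_eq_zero (s := Finset.range (m + 1))
      (v := fun j : ℕ => (j : ℂ)) (injOn_natCast _)
      (by rw [Finset.card_range]; exact hR.trans (by norm_cast; omega)) fun i hi => ?_
    have hi' : i ≤ m := by simpa [Nat.lt_succ_iff] using hi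
    have := hT1 i hi'
    rw [hTR, eval_derivative_gridNodal_mul hi', hc] at this
    exact (mul_eq_zero.1 this).resolve_left (gridWeight_ne_zero hi')
  rw [hR0, mul_zero] at hTR
  rwa [hTR, eq_comm, sub_eq_zero] at hT

/-! ### The interpolant of the binomial coefficients -/

lemma ratCast_alternating_sum (m : ℕ) (f : ℕ → ℚ) :
    ((∑ k ∈ Finset.range (m + 1), (-1 : ℚ) ^ k * (m.choose k : ℚ) ^ 2 * f k : ℚ) : ℂ) =
      ∑ k ∈ Finset.range (m + 1), (-1 : ℂ) ^ k * (m.choose k : ℂ) ^ 2 * (f k : ℂ) := by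
  push_cast; rfl

lemma neg_one_pow_sub_of_odd {m i : ℕ} (hm : Odd m) (hi : i ≤ m) :
    (-1 : ℂ) ^ (m - i) = -(-1) ^ i := by
  have h : (-1 : ℂ) ^ (m - i) * (-1) ^ i = -1 := by
    rw [← pow_add, Nat.sub_add_cancel hi, hm.neg_one_pow]
  rcases neg_one_pow_eq_or ℂ i with h2 | h2 <;> rw [h2] at h ⊢ <;> linear_combination (norm := ring_nf) h
  all_goals linear_combination (-2 : ℂ) * h

/-- The top coefficient of the interpolant of the binomial coefficients. -/
lemma coeff_interpolant_choose (n : ℕ) (R : ℂ[X]) (hR : R.degree < ((2 * n + 1 : ℕ) : WithBot ℕ))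
    (hev : ∀ i ≤ 2 * n + 1, R.eval (i : ℂ) = (2 * n + 1).choose i) :
    R.coeff (2 * n) = (-1) ^ n / (n.factorial : ℂ) ^ 2 := by
  -- Multiplication by `X` raises the degree bound to that of full interpolation at `2n + 2` nodes,
  -- so the coefficient becomes the linear moment.
  have hdeg : (X * R).degree < ((2 * n + 1 + 1 : ℕ) : WithBot ℕ) := by
    rw [degree_lt_iff_coeff_zero] at hR ⊢
    intro k hk
    obtain ⟨k, rfl⟩ : ∃ k', k = k' + 1 := ⟨k - 1, by omega⟩
    rw [coeff_X_mul]
    exact hR k (by omega)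
  have h := coeff_eq_sum_grid (X * R) hdeg
  rw [coeff_X_mul] at h
  have hf : ((2 * n + 1).factorial : ℂ) ≠ 0 := by exact_mod_cast (2 * n + 1).factorial_ne_zero
  have h1 : ∀ i ∈ Finset.range (2 * n + 1 + 1), (X * R).eval (i : ℂ) / gridWeight (2 * n + 1) i =
      (-1 / ((2 * n + 1).factorial : ℂ)) *
        ((-1 : ℂ) ^ i * ((2 * n + 1).choose i : ℂ) ^ 2 * ((i : ℚ) : ℂ)) := by
    intro i hi
    have hi' : i ≤ 2 * n + 1 := by simpa [Nat.lt_succ_iff] using hi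
    rw [div_eq_mul_inv, inv_gridWeight hi', neg_one_pow_sub_of_odd ⟨n, rfl⟩ hi', eval_mul, eval_X,
      hev i hi']
    push_cast
    field_simp
  rw [h, Finset.sum_congr rfl h1, ← Finset.mul_sum, ← ratCast_alternating_sum,
    alternating_choose_sq_linear_moment]
  have hn : (n.factorial : ℂ) ≠ 0 := by exact_mod_cast n.factorial_ne_zero
  push_cast
  rw [pow_succ]
  field_simp

/-- The interpolant of the binomial coefficients satisfies their two-term recurrence up to a
multiple of the nodal polynomial of the first `k + 1` nodes. -/
lemma interpolant_choose_recurrence (k : ℕ) (R : ℂ[X])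
    (hR : R.degree < ((k + 1 : ℕ) : WithBot ℕ))
    (hev : ∀ i ≤ k + 1, R.eval (i : ℂ) = (k + 1).choose i) :
    (C ((k : ℂ) + 1) - X) * R - (X + C 1) * taylor 1 R =
      C (-2 * R.coeff k) * gridNodal k := by
  have hc := (degree_lt_iff_coeff_zero _ _).1 hR
  have htdeg : (taylor 1 R).degree < ((k + 1 : ℕ) : WithBot ℕ) := by rwa [degree_taylor]
  have htc := (degree_lt_iff_coeff_zero _ _).1 htdeg
  have htop : (taylor 1 R).coeff k = R.coeff k := by
    rcases eq_or_ne R.natDegree k with h | h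
    · rw [← h, coeff_taylor_natDegree]; rfl
    · have h1 : R.natDegree ≤ k := by
        rcases eq_or_ne R 0 with rfl | h0
        · simp
        · rw [degree_eq_natDegree h0, Nat.cast_lt] at hR; omega
      rw [coeff_eq_zero_of_natDegree_lt (by rw [natDegree_taylor]; omega),
        coeff_eq_zero_of_natDegree_lt (by omega)]
  have hW : (gridNodal k).natDegree = k + 1 := by simp
  have hWtop : (gridNodal k).coeff (k + 1) = 1 := by
    have := Lagrange.nodal_monic (s := Finset.range (k + 1)) (v := fun j : ℕ => (j : ℂ))
    rw [Monic, leadingCoeff, hW] at this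
    exact this
  rw [← sub_eq_zero]
  -- Both products on the left contribute `-R.coeff k` in degree `k + 1`; after subtracting the
  -- right side the degree is at most `k`, with zeros at `k + 1` nodes.
  refine Polynomial.eq_zero_of_degree_lt_of_eval_index_eq_zero (s := Finset.range (k + 1))
      (v := fun j : ℕ => (j : ℂ)) (injOn_natCast _) ?_ fun i hi => ?_
  · rw [Finset.card_range, degree_lt_iff_coeff_zero]
    intro p hp
    obtain ⟨p, rfl⟩ : ∃ p', p = p' + 1 := ⟨p - 1, by omega⟩
    simp only [coeff_sub, sub_mul, add_mul, coeff_add, coeff_C_mul, coeff_X_mul]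
    rcases (show k ≤ p by omega).eq_or_lt with rfl | hlt
    · rw [hc _ le_rfl, htc _ le_rfl, htop, hWtop]; ring
    · rw [hc _ (by omega), htc _ (by omega), hc _ (by omega), htc _ (by omega),
        coeff_eq_zero_of_natDegree_lt (p := gridNodal k) (by omega)]
      ring
  · have hi' : i ≤ k := by simpa [Nat.lt_succ_iff] using hi
    have h1 : R.eval ((i : ℂ) + 1) = (k + 1).choose (i + 1) := by
      rw [← hev (i + 1) (by omega)]; push_cast; rfl
    have h2 := choose_succ_mul_cast (show i ≤ k + 1 by omega)
    have h3 : (((k + 1).choose (i + 1) : ℂ)) * (i + 1) = (k + 1).choose i * (k + 1 - i) := by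
      exact_mod_cast congrArg (fun q : ℚ => (q : ℂ)) h2
    simp only [eval_sub, eval_mul, eval_add, eval_C, eval_X, taylor_eval, eval_gridNodal hi',
      hev i (by omega), h1]
    linear_combination -h3

lemma eval_derivative_taylor (R : ℂ[X]) (x : ℂ) :
    (derivative (taylor 1 R)).eval x = (derivative R).eval (x + 1) := by
  rw [taylor_apply, derivative_comp]; simp

lemma interpolant_choose_derivative_recurrence {k : ℕ} (R : ℂ[X])
    (hR : R.degree < ((k + 1 : ℕ) : WithBot ℕ))
    (hev : ∀ i ≤ k + 1, R.eval (i : ℂ) = (k + 1).choose i) {i : ℕ} (hi : i ≤ k) :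
    ((k : ℂ) + 1 - i) * (derivative R).eval (i : ℂ) -
      ((i : ℂ) + 1) * (derivative R).eval ((i : ℂ) + 1) -
      (k + 1).choose i - (k + 1).choose (i + 1) = -2 * R.coeff k * gridWeight k i := by
  have h := congrArg (fun P => (derivative P).eval (i : ℂ)) (interpolant_choose_recurrence k R hR hev)
  have h1 : R.eval ((i : ℂ) + 1) = (k + 1).choose (i + 1) := by
    rw [← hev (i + 1) (by omega)]; push_cast; rfl
  simp only [derivative_sub, derivative_mul, derivative_add, derivative_C, derivative_X, eval_sub,
    eval_mul, eval_add, eval_C, eval_X, eval_derivative_taylor, taylor_eval, h1,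
    hev i (by omega), eval_derivative_gridNodal hi, eval_zero, eval_one] at h
  linear_combination h

lemma interpolant_choose_derivative_symm {m : ℕ} (R : ℂ[X])
    (hR : R.degree < (m : WithBot ℕ))
    (hev : ∀ i ≤ m, R.eval (i : ℂ) = m.choose i) (x : ℂ) :
    (derivative R).eval (m - x) = -(derivative R).eval x := by
  have hlin : (C (m : ℂ) - X : ℂ[X]).natDegree ≤ 1 := by
    refine (natDegree_sub_le _ _).trans ?_
    simp
  -- Both sides interpolate the same symmetric data at `m + 1` nodes.
  have hsymm : R.comp (C (m : ℂ) - X) = R := by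
    refine Polynomial.eq_of_degrees_lt_of_eval_index_eq (s := Finset.range (m + 1))
      (v := fun j : ℕ => (j : ℂ)) (injOn_natCast _) ?_ ?_ fun i hi => ?_
    · rw [Finset.card_range]
      rcases eq_or_ne R 0 with rfl | h0
      · simp
      · rw [degree_eq_natDegree h0, Nat.cast_lt] at hR
        refine degree_le_natDegree.trans_lt ?_
        rw [Nat.cast_lt]
        calc _ ≤ R.natDegree * (C (m : ℂ) - X : ℂ[X]).natDegree := natDegree_comp_le
          _ ≤ R.natDegree * 1 := Nat.mul_le_mul_left _ hlin
          _ < m + 1 := by omega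
    · rw [Finset.card_range]; exact hR.trans (by norm_cast; omega)
    · have hi' : i ≤ m := by simpa [Nat.lt_succ_iff] using hi
      have : (m : ℂ) - i = ((m - i : ℕ) : ℂ) := by rw [Nat.cast_sub hi']
      rw [eval_comp, eval_sub, eval_C, eval_X, this, hev _ (by omega), hev i hi',
        Nat.choose_symm hi']
  have h := congrArg (fun P => (derivative P).eval x) hsymm
  simp only [derivative_comp, derivative_sub, derivative_C, derivative_X, eval_mul, eval_comp,
    eval_sub, eval_C, eval_X, eval_zero, eval_one] at h
  linear_combination -h

/-- The two middle nodes `t + 1` and `t + 2` are exchanged by the symmetry, so the recurrence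
between them gives R' at `t + 2`; one more step of it reaches `t + 3`. -/
lemma interpolant_choose_derivative_at (t : ℕ) (R : ℂ[X])
    (hR : R.degree < ((2 * t + 3 : ℕ) : WithBot ℕ))
    (hev : ∀ i ≤ 2 * t + 3, R.eval (i : ℂ) = (2 * t + 3).choose i) :
    (derivative R).eval ((t + 3 : ℕ) : ℂ) +
        gridLogDeriv (2 * t + 3) (t + 3) * (2 * t + 3).choose (t + 3) =
      (((t : ℂ) + 1) / (t + 2) - 2 * (t + 2) / (t + 1)) / (t + 3) := by
  have hc : R.coeff (2 * t + 2) = (-1) ^ (t + 1) / ((t + 1).factorial : ℂ) ^ 2 :=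
    coeff_interpolant_choose (t + 1) R hR hev
  have r1 := interpolant_choose_derivative_recurrence (k := 2 * t + 2) R hR hev
    (i := t + 1) (by omega)
  have r2 := interpolant_choose_derivative_recurrence (k := 2 * t + 2) R hR hev
    (i := t + 2) (by omega)
  have s := interpolant_choose_derivative_symm (m := 2 * t + 3) R hR hev ((t + 2 : ℕ) : ℂ)
  have f0 : (t.factorial : ℂ) ≠ 0 := by exact_mod_cast t.factorial_ne_zero
  have t1 : (t : ℂ) + 1 ≠ 0 := by exact_mod_cast t.succ_ne_zero
  have t2 : (t : ℂ) + 2 ≠ 0 := by exact_mod_cast (t + 1).succ_ne_zero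
  have t3 : (t : ℂ) + 3 ≠ 0 := by exact_mod_cast (t + 2).succ_ne_zero
  have sg : ((-1 : ℂ) ^ t) ^ 2 = 1 := by rw [← pow_mul, mul_comm, pow_mul]; simp
  rw [gridWeight_eq (by omega), hc, show 2 * t + 2 - (t + 1) = t + 1 by omega] at r1
  rw [gridWeight_eq (by omega), hc, show 2 * t + 2 - (t + 2) = t by omega] at r2
  have w1 : -2 * ((-1 : ℂ) ^ (t + 1) / ((t + 1).factorial : ℂ) ^ 2) *
      ((-1) ^ (t + 1) * ((t + 1).factorial * (t + 1).factorial)) = -2 := by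
    rw [Nat.factorial_succ, pow_succ]
    push_cast
    field_simp
    linear_combination -sg
  have w2 : -2 * ((-1 : ℂ) ^ (t + 1) / ((t + 1).factorial : ℂ) ^ 2) *
      ((-1) ^ t * ((t + 2).factorial * t.factorial)) = 2 * (t + 2) / (t + 1) := by
    rw [Nat.factorial_succ (t + 1), Nat.factorial_succ t, pow_succ]
    push_cast
    field_simp
    linear_combination (t + 2 : ℂ) * sg
  rw [w1] at r1
  rw [w2] at r2
  have b1 : (2 * t + 2 + 1).choose (t + 1) = (2 * t + 3).choose (t + 2) := by
    rw [← Nat.choose_symm (show t + 2 ≤ 2 * t + 3 by omega)]; congr 1; omega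
  have b2 := congrArg (fun q : ℚ => (q : ℂ)) (choose_succ_mul_cast (m := 2 * t + 3) (k := t + 2)
    (by omega))
  have hω : gridLogDeriv (2 * t + 3) (t + 3) =
      1 / ((t : ℂ) + 1) + 1 / (t + 2) + 1 / (t + 3) := by
    rw [gridLogDeriv, show 2 * t + 3 - (t + 3) = t by omega, harmonic_succ, harmonic_succ,
      harmonic_succ]
    push_cast
    rw [show (t : ℂ) + 1 + 1 = t + 2 by ring, show (t : ℂ) + 2 + 1 = t + 3 by ring]
    field_simp
    ring
  rw [hω]
  rw [b1] at r1
  rw [show 2 * t + 2 + 1 = 2 * t + 3 by ring, show t + 1 + 1 = t + 2 by ring] at r1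
  rw [show 2 * t + 2 + 1 = 2 * t + 3 by ring, show t + 2 + 1 = t + 3 by ring] at r2
  rw [show t + 2 + 1 = t + 3 by ring] at b2
  push_cast at r1 r2 s b2 ⊢
  rw [show (2 * (t : ℂ) + 3 - (t + 2)) = t + 1 by ring] at s
  rw [show (t : ℂ) + 1 + 1 = t + 2 by ring, s] at r1
  rw [show (t : ℂ) + 2 + 1 = t + 3 by ring] at r2
  generalize (derivative R).eval ((t : ℂ) + 2) = x at *
  generalize (derivative R).eval ((t : ℂ) + 3) = y at *
  generalize (((2 * t + 3).choose (t + 2) : ℕ) : ℂ) = B at *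
  generalize (((2 * t + 3).choose (t + 3) : ℕ) : ℂ) = B' at *
  have hx : x = (1 - B) / (t + 2) := by field_simp; linear_combination -r1 / 2
  have hB' : B' = B * (t + 1) / (t + 3) := by field_simp; linear_combination b2
  have hy : y = ((t + 1) * x - B - B' - 2 * (t + 2) / (t + 1)) / (t + 3) := by
    field_simp at r2 ⊢; linear_combination -r2
  rw [hy, hB', hx]
  field_simp
  ring

/-! ### From cell averages to increments on the unit grid -/

/-- The affine coordinate in which the faces of the stencil are `0, …, l + r`. -/
noncomputable def stencilCoord (l : ℕ) (h : ℝ) (j : ℤ) : ℂ[X] :=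
  C ((h : ℂ)⁻¹) * X - C ((face h (j - l) : ℂ) / h)

lemma eval_stencilCoord_face {h : ℝ} (hh : h ≠ 0) (l : ℕ) (j k : ℤ) :
    (stencilCoord l h j).eval (face h (j + k) : ℂ) = l + k := by
  have : (h : ℂ) ≠ 0 := by exact_mod_cast hh
  simp only [stencilCoord, face, eval_sub, eval_mul, eval_C, eval_X]
  push_cast
  field_simp
  ring

lemma derivative_stencilCoord (l : ℕ) (h : ℝ) (j : ℤ) :
    derivative (stencilCoord l h j) = C ((h : ℂ)⁻¹) := by
  simp [stencilCoord, derivative_mul]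

lemma natDegree_stencilCoord {h : ℝ} (hh : h ≠ 0) (l : ℕ) (j : ℤ) :
    (stencilCoord l h j).natDegree = 1 := by
  have : (h : ℂ)⁻¹ ≠ 0 := inv_ne_zero (by exact_mod_cast hh)
  rw [stencilCoord, natDegree_sub_C, natDegree_C_mul_X _ this]

lemma cellAverage_derivative (h : ℝ) (j : ℤ) (S : ℂ[X]) :
    cellAverage h j (derivative S) =
      (S.eval (face h j : ℂ) - S.eval (face h (j - 1) : ℂ)) / h := by
  rw [cellAverage, intervalIntegral.integral_eq_sub_of_hasDerivAt
    (f := fun x : ℝ => S.eval (x : ℂ)) (fun x _ => (S.hasDerivAt (x : ℂ)).comp_ofReal)]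
  · ring
  · refine Continuous.intervalIntegrable ?_ _ _
    exact (derivative S).continuous.comp Complex.continuous_ofReal

lemma derivative_C_mul_comp_stencilCoord {h : ℝ} (hh : h ≠ 0) (l : ℕ) (j : ℤ) (Q : ℂ[X]) :
    derivative (C (h : ℂ) * Q.comp (stencilCoord l h j)) =
      (derivative Q).comp (stencilCoord l h j) := by
  have : (h : ℂ) ≠ 0 := by exact_mod_cast hh
  rw [derivative_C_mul, derivative_comp, derivative_stencilCoord, ← mul_assoc, ← C_mul,
    mul_inv_cancel₀ this, C_1, one_mul]

lemma cellAverage_comp_stencilCoord {h : ℝ} (hh : h ≠ 0) (l : ℕ) (j k : ℤ) (Q : ℂ[X]) :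
    cellAverage h (j + k) ((derivative Q).comp (stencilCoord l h j)) =
      Q.eval ((l : ℂ) + k) - Q.eval ((l : ℂ) + k - 1) := by
  have : (h : ℂ) ≠ 0 := by exact_mod_cast hh
  rw [← derivative_C_mul_comp_stencilCoord hh, cellAverage_derivative, add_sub_assoc]
  simp only [eval_mul, eval_C, eval_comp, eval_stencilCoord_face hh]
  push_cast
  rw [← add_sub_assoc]
  field_simp

lemma cellAverage_derivative_comp_stencilCoord {h : ℝ} (hh : h ≠ 0) (l : ℕ) (j k : ℤ)
    (Q : ℂ[X]) :
    cellAverage h (j + k) (derivative ((derivative Q).comp (stencilCoord l h j))) =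
      ((derivative Q).eval ((l : ℂ) + k) - (derivative Q).eval ((l : ℂ) + k - 1)) / h := by
  rw [cellAverage_derivative, add_sub_assoc]
  simp only [eval_comp, eval_stencilCoord_face hh]
  push_cast
  rw [← add_sub_assoc]

/-- `Q` solves the reconstruction problem in the coordinates of the stencil. -/
def IsUnitReconstruction (l r : ℕ) (h : ℝ) (u v : ℤ → ℂ) (j : ℤ) (Q : ℂ[X]) : Prop :=
  Q.degree < ((2 * (l + r) + 1 : ℕ) : WithBot ℕ) ∧ ∀ i < l + r,
    Q.eval ((i : ℂ) + 1) - Q.eval (i : ℂ) = u (j - l + 1 + i) ∧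
    (derivative Q).eval ((i : ℂ) + 1) - (derivative Q).eval (i : ℂ) = h * v (j - l + 1 + i)

lemma degree_lt_of_degree_derivative_lt {d : ℕ} {Q : ℂ[X]}
    (h : (derivative Q).degree < (d : WithBot ℕ)) : Q.degree < ((d + 1 : ℕ) : WithBot ℕ) := by
  rw [degree_lt_iff_coeff_zero] at h ⊢
  intro k hk
  obtain ⟨k, rfl⟩ : ∃ k', k = k' + 1 := ⟨k - 1, by omega⟩
  have h1 := h k (by omega)
  rw [coeff_derivative] at h1
  exact (mul_eq_zero.1 h1).resolve_right (by exact_mod_cast k.succ_ne_zero)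

lemma degree_derivative_lt_of_degree_lt {d : ℕ} {Q : ℂ[X]}
    (h : Q.degree < ((d + 1 : ℕ) : WithBot ℕ)) : (derivative Q).degree < (d : WithBot ℕ) := by
  rw [degree_lt_iff_coeff_zero] at h ⊢
  intro k hk
  rw [coeff_derivative, h (k + 1) (by omega), zero_mul]

lemma degree_comp_lt_of_natDegree_eq_one {d : ℕ} {P A : ℂ[X]} (hA : A.natDegree = 1)
    (h : P.degree < (d : WithBot ℕ)) : (P.comp A).degree < (d : WithBot ℕ) := by
  rcases eq_or_ne P 0 with rfl | h0
  · simp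
  · rw [degree_eq_natDegree h0, Nat.cast_lt] at h
    refine degree_le_natDegree.trans_lt ?_
    rw [Nat.cast_lt, natDegree_comp, hA, mul_one]
    exact h

lemma exists_derivative_eq (P : ℂ[X]) : ∃ Q : ℂ[X], derivative Q = P := by
  induction P using Polynomial.induction_on' with
  | add p q hp hq =>
    obtain ⟨p', rfl⟩ := hp
    obtain ⟨q', rfl⟩ := hq
    exact ⟨p' + q', derivative_add⟩
  | monomial n a =>
    refine ⟨monomial (n + 1) (a / (n + 1)), ?_⟩
    rw [derivative_monomial]
    have : (n : ℂ) + 1 ≠ 0 := by exact_mod_cast n.succ_ne_zero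
    congr 1
    push_cast
    field_simp

lemma IsUnitReconstruction.isReconstruction {l r : ℕ} {h : ℝ} (hh : h ≠ 0) {u v : ℤ → ℂ} {j : ℤ}
    {Q : ℂ[X]} (hQ : IsUnitReconstruction l r h u v j Q) :
    IsReconstruction l r h u v j ((derivative Q).comp (stencilCoord l h j)) := by
  have hc : (h : ℂ) ≠ 0 := by exact_mod_cast hh
  refine ⟨?_, fun k hk1 hk2 => ?_⟩
  · rw [show 2 * l + 2 * r = 2 * (l + r) by ring]
    exact degree_comp_lt_of_natDegree_eq_one (natDegree_stencilCoord hh l j)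
      (degree_derivative_lt_of_degree_lt hQ.1)
  · obtain ⟨i, hi⟩ : ∃ i : ℕ, (i : ℤ) = l + k - 1 := ⟨(l + k - 1).toNat, by omega⟩
    have h1 := hQ.2 i (by omega)
    have hi' : (l : ℂ) + k - 1 = i := by exact_mod_cast hi.symm
    rw [cellAverage_comp_stencilCoord hh, cellAverage_derivative_comp_stencilCoord hh,
      show (l : ℂ) + k = i + 1 by rw [← hi']; ring, add_sub_cancel_right, h1.1, h1.2,
      show j - l + 1 + i = j + k by omega]
    exact ⟨rfl, by field_simp⟩

lemma IsReconstruction.exists_isUnitReconstruction {l r : ℕ} {h : ℝ} (hh : h ≠ 0) {u v : ℤ → ℂ}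
    {j : ℤ} {P : ℂ[X]} (hP : IsReconstruction l r h u v j P) :
    ∃ Q, IsUnitReconstruction l r h u v j Q ∧ P = (derivative Q).comp (stencilCoord l h j) := by
  have hc : (h : ℂ) ≠ 0 := by exact_mod_cast hh
  -- The inverse of `stencilCoord`.
  set B : ℂ[X] := C (h : ℂ) * X + C (face h (j - l) : ℂ) with hB
  have hBdeg : B.natDegree = 1 := by rw [hB, natDegree_add_C, natDegree_C_mul_X _ hc]
  obtain ⟨Q, hQ⟩ := exists_derivative_eq (P.comp B)
  have hPQ : P = (derivative Q).comp (stencilCoord l h j) := by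
    rw [hQ, comp_assoc, hB, stencilCoord]
    simp only [add_comp, mul_comp, C_comp, X_comp]
    rw [mul_sub, ← mul_assoc, ← C_mul, ← C_mul, mul_inv_cancel₀ hc, mul_div_cancel₀ _ hc]
    simp
  refine ⟨Q, ⟨?_, fun i hi => ?_⟩, hPQ⟩
  · refine degree_lt_of_degree_derivative_lt ?_
    rw [hQ, show 2 * (l + r) = 2 * l + 2 * r by ring]
    exact degree_comp_lt_of_natDegree_eq_one hBdeg hP.1
  · have h1 := hP.2 ((i : ℤ) - l + 1) (by omega) (by omega)
    rw [hPQ, cellAverage_comp_stencilCoord hh, cellAverage_derivative_comp_stencilCoord hh] at h1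
    push_cast at h1
    rw [show (l : ℂ) + (i - l + 1) = i + 1 by ring, add_sub_cancel_right,
      show j + ((i : ℤ) - l + 1) = j - l + 1 + i by ring] at h1
    refine ⟨h1.1, ?_⟩
    rw [← h1.2]
    field_simp

lemma exists_isUnitReconstruction (l r : ℕ) (h : ℝ) (u v : ℤ → ℂ) (j : ℤ) :
    ∃ Q, IsUnitReconstruction l r h u v j Q :=
  exists_hermite_differences (l + r) (fun i => u (j - l + 1 + i)) fun i => h * v (j - l + 1 + i)

lemma IsUnitReconstruction.derivative_unique {l r : ℕ} {h : ℝ} {u v : ℤ → ℂ} {j : ℤ}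
    {Q₁ Q₂ : ℂ[X]} (h₁ : IsUnitReconstruction l r h u v j Q₁)
    (h₂ : IsUnitReconstruction l r h u v j Q₂) : derivative Q₁ = derivative Q₂ := by
  obtain ⟨a, ha⟩ := eq_C_of_hermite_differences (m := l + r) (Q₁ - Q₂)
    ((degree_sub_le _ _).trans_lt (max_lt h₁.1 h₂.1)) fun i hi => by
      have e₁ := h₁.2 i hi
      have e₂ := h₂.2 i hi
      simp only [derivative_sub, eval_sub]
      exact ⟨by linear_combination e₁.1 - e₂.1, by linear_combination e₁.2 - e₂.2⟩
  rw [← sub_eq_zero, ← derivative_sub, ha, derivative_C]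

theorem existsUnique_isReconstruction (l r : ℕ) {h : ℝ} (hh : h ≠ 0) (u v : ℤ → ℂ) (j : ℤ) :
    ∃! P : ℂ[X], IsReconstruction l r h u v j P := by
  obtain ⟨Q, hQ⟩ := exists_isUnitReconstruction l r h u v j
  refine ⟨_, hQ.isReconstruction hh, fun P hP => ?_⟩
  obtain ⟨Q', hQ', rfl⟩ := hP.exists_isUnitReconstruction hh
  rw [hQ'.derivative_unique hQ]

/-- Uniqueness pins down the choice made by `Classical.epsilon`. -/
lemma IsUnitReconstruction.reconstruction_eq {l r : ℕ} {h : ℝ} (hh : h ≠ 0) {u v : ℤ → ℂ} {j : ℤ}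
    {Q : ℂ[X]} (hQ : IsUnitReconstruction l r h u v j Q) :
    reconstruction l r h u v j = (derivative Q).comp (stencilCoord l h j) :=
  (existsUnique_isReconstruction l r hh u v j).unique
    (Classical.epsilon_spec ⟨_, hQ.isReconstruction hh⟩) (hQ.isReconstruction hh)

lemma IsUnitReconstruction.fluxF_eq {l r : ℕ} {h : ℝ} (hh : h ≠ 0) {u v : ℤ → ℂ} {j : ℤ}
    {Q : ℂ[X]} (hQ : IsUnitReconstruction l r h u v j Q) :
    fluxF l r h u v j = (derivative Q).eval (l : ℂ) := by
  have := eval_stencilCoord_face hh l j 0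
  rw [add_zero] at this
  rw [fluxF, hQ.reconstruction_eq hh, eval_comp, this]
  simp

lemma IsUnitReconstruction.fluxH_eq {l r : ℕ} {h : ℝ} (hh : h ≠ 0) {u v : ℤ → ℂ} {j : ℤ}
    {Q : ℂ[X]} (hQ : IsUnitReconstruction l r h u v j Q) :
    fluxH l r h u v j = (derivative (derivative Q)).eval (l : ℂ) / h := by
  have := eval_stencilCoord_face hh l j 0
  rw [add_zero] at this
  rw [fluxH, hQ.reconstruction_eq hh, derivative_comp, derivative_stencilCoord, eval_mul, eval_comp,
    this]
  simp
  ring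

/-! ### Sawtooth data -/

lemma eval_eq_of_alternating_differences {m : ℕ} (f : ℂ[X]) (h : ∀ i < m,
    f.eval ((i : ℂ) + 1) - f.eval (i : ℂ) = (-1) ^ (i + 1)) :
    ∀ i ≤ m, f.eval (i : ℂ) = (-1) ^ i / 2 + (f.eval 0 - 1 / 2) := by
  intro i
  induction i with
  | zero => intro _; simp
  | succ i ih =>
    intro hi
    have h1 := h i hi
    rw [ih (by omega)] at h1
    push_cast
    rw [pow_succ] at h1 ⊢
    linear_combination h1

lemma eval_eq_of_zero_differences {m : ℕ} (f : ℂ[X]) (h : ∀ i < m,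
    f.eval ((i : ℂ) + 1) - f.eval (i : ℂ) = 0) : ∀ i ≤ m, f.eval (i : ℂ) = f.eval 0 := by
  intro i
  induction i with
  | zero => simp
  | succ i ih =>
    intro hi
    have h1 := h i hi
    rw [ih (by omega)] at h1
    push_cast
    linear_combination h1

/-- For odd `m`, reflection turns the sum with `harmonic (m - k)` into minus the one with `harmonic
k`, so the two parts add up. -/
lemma sum_alternating_choose_sq_gridLogDeriv {m : ℕ} (hm : Odd m) :
    ∑ i ∈ Finset.range (m + 1), (-1 : ℂ) ^ i * (m.choose i : ℂ) ^ 2 * gridLogDeriv m i =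
      2 * ((∑ k ∈ Finset.range (m + 1), (-1 : ℚ) ^ k * (m.choose k : ℚ) ^ 2 * harmonic k : ℚ) :
        ℂ) := by
  have h := alternating_choose_sq_reflect hm harmonic
  simp only [gridLogDeriv]
  rw [← ratCast_alternating_sum]
  simp only [mul_sub, Finset.sum_sub_distrib]
  rw [neg_eq_iff_eq_neg.1 h.symm]
  push_cast
  ring

/-- The face derivative for the alternating data in the cell averages of the solution. -/
lemma eval_derivative_of_alternating_values {m : ℕ} (hm : Odd m) (Q : ℂ[X])
    (hQ : Q.degree < ((2 * m + 1 : ℕ) : WithBot ℕ))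
    (h : ∀ i < m, Q.eval ((i : ℂ) + 1) - Q.eval (i : ℂ) = (-1) ^ (i + 1) ∧
      (derivative Q).eval ((i : ℂ) + 1) - (derivative Q).eval (i : ℂ) = 0) {l : ℕ} (hl : l ≤ m) :
    (derivative Q).eval (l : ℂ) * Nat.centralBinom m =
      2 * ((∑ k ∈ Finset.range (m + 1), (-1 : ℚ) ^ k * (m.choose k : ℚ) ^ 2 * harmonic k : ℚ) :
        ℂ) := by
  have hv := eval_eq_of_alternating_differences Q fun i hi => (h i hi).1
  have hd := eval_eq_of_zero_differences (derivative Q) fun i hi => (h i hi).2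
  set a := Q.eval 0 - 1 / 2 with ha
  have hf := hermite_functional_eq_zero (Q - C a)
    ((degree_sub_le _ _).trans_lt (max_lt hQ (degree_C_le.trans_lt (by norm_cast; omega))))
  have e : ∀ i ∈ Finset.range (m + 1), (m.choose i : ℂ) ^ 2 *
      ((derivative (Q - C a)).eval (i : ℂ) - 2 * (Q - C a).eval (i : ℂ) * gridLogDeriv m i) =
      (m.choose i : ℂ) ^ 2 * (derivative Q).eval 0 -
        (-1) ^ i * (m.choose i : ℂ) ^ 2 * gridLogDeriv m i := by
    intro i hi
    have hi' : i ≤ m := by simpa [Nat.lt_succ_iff] using hi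
    rw [derivative_sub, derivative_C, sub_zero, hd i hi', eval_sub, eval_C, hv i hi']
    ring
  rw [Finset.sum_congr rfl e, Finset.sum_sub_distrib, ← Finset.sum_mul, sum_choose_sq_cast,
    sum_alternating_choose_sq_gridLogDeriv hm] at hf
  rw [hd l hl]
  linear_combination hf

/-- The second face derivative for the alternating data in the cell averages of the derivative. -/
lemma eval_derivative2_of_alternating_derivatives (t : ℕ) (Q : ℂ[X])
    (hQ : Q.degree < ((2 * (2 * t + 3) + 1 : ℕ) : WithBot ℕ))
    (h : ∀ i < 2 * t + 3, Q.eval ((i : ℂ) + 1) - Q.eval (i : ℂ) = 0 ∧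
      (derivative Q).eval ((i : ℂ) + 1) - (derivative Q).eval (i : ℂ) = (-1) ^ (i + 1)) :
    (derivative (derivative Q)).eval ((t + 3 : ℕ) : ℂ) * (2 * t + 3).choose (t + 3) =
      -(-1) ^ t * ((((t : ℂ) + 1) / (t + 2) - 2 * (t + 2) / (t + 1)) / (t + 3)) := by
  set m := 2 * t + 3 with hm
  have hodd : Odd m := ⟨t + 1, by omega⟩
  have hlm : t + 3 ≤ m := by omega
  have hv := eval_eq_of_zero_differences Q fun i hi => (h i hi).1
  have hd := eval_eq_of_alternating_differences (derivative Q) fun i hi => (h i hi).2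
  set T := Q - C (Q.eval 0) with hT
  have hTdeg : T.degree < ((2 * m + 1 : ℕ) : WithBot ℕ) :=
    (degree_sub_le _ _).trans_lt (max_lt hQ (degree_C_le.trans_lt (by norm_cast; omega)))
  have hT' : derivative T = derivative Q := by simp [hT]
  have hT0 : ∀ i ≤ m, T.eval (i : ℂ) = 0 := fun i hi => by simp [hT, hv i hi]
  -- The functional and the vanishing alternating sum leave the nodal derivatives as exactly `(-1)^i
  -- / 2`.
  have hc : (derivative Q).eval 0 - 1 / 2 = 0 := by
    have hf := hermite_functional_eq_zero T hTdeg
    have e : ∀ i ∈ Finset.range (m + 1), (m.choose i : ℂ) ^ 2 *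
        ((derivative T).eval (i : ℂ) - 2 * T.eval (i : ℂ) * gridLogDeriv m i) =
        (-1) ^ i * (m.choose i : ℂ) ^ 2 * ((1 / 2 : ℚ) : ℂ) +
          (m.choose i : ℂ) ^ 2 * ((derivative Q).eval 0 - 1 / 2) := by
      intro i hi
      have hi' : i ≤ m := by simpa [Nat.lt_succ_iff] using hi
      rw [hT', hd i hi', hT0 i hi']
      push_cast
      ring
    have h0 : ∑ i ∈ Finset.range (m + 1),
        (-1 : ℂ) ^ i * (m.choose i : ℂ) ^ 2 * ((1 / 2 : ℚ) : ℂ) = 0 := by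
      rw [← ratCast_alternating_sum m fun _ => 1 / 2, ← Finset.sum_mul,
        alternating_choose_sq_of_odd hodd, zero_mul, Rat.cast_zero]
    rw [Finset.sum_congr rfl e, Finset.sum_add_distrib, h0, zero_add, ← Finset.sum_mul,
      sum_choose_sq_cast] at hf
    exact (mul_eq_zero.1 hf).resolve_left (centralBinom_cast_ne_zero m)
  obtain ⟨R, hR, hTR⟩ := exists_eq_gridNodal_mul T hTdeg hT0
  have hfac : (m.factorial : ℂ) ≠ 0 := by exact_mod_cast m.factorial_ne_zero
  -- The sign in the inverse weight cancels the sawtooth up to a global sign, leaving a multiple of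
  -- the binomials.
  have hReval : ∀ i ≤ m, R.eval (i : ℂ) = (-1 / (2 * (m.factorial : ℂ))) * m.choose i := by
    intro i hi
    have h1 := eval_derivative_gridNodal_mul hi R
    rw [← hTR, hT', hd i hi, hc, add_zero] at h1
    have h0 := gridWeight_ne_zero hi
    have h2 := inv_gridWeight hi
    have h3 : R.eval (i : ℂ) = (-1) ^ i / 2 * (gridWeight m i)⁻¹ := by
      rw [h1]; field_simp
    have h4 : ((-1 : ℂ) ^ i) ^ 2 = 1 := by rw [← pow_mul, mul_comm, pow_mul]; simp
    rw [h3, h2, neg_one_pow_sub_of_odd hodd hi]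
    field_simp
    linear_combination (-(m.choose i : ℂ)) * h4
  have hS := interpolant_choose_derivative_at t (C (-2 * (m.factorial : ℂ)) * R)
    (by
      rw [← smul_eq_C_mul]
      exact (degree_smul_le _ _).trans_lt hR)
    (fun i hi => by
      rw [eval_mul, eval_C, hReval i hi, ← hm]
      field_simp)
  rw [derivative_C_mul, eval_mul, eval_C] at hS
  have hw := gridWeight_mul_choose hlm
  rw [show m - (t + 3) = t by omega] at hw
  -- Writing `T` as `(X - (t + 3))` times a cofactor, the second derivative there is twice the first
  -- derivative of the cofactor.
  have hQ2 : (derivative (derivative Q)).eval ((t + 3 : ℕ) : ℂ) =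
      2 * (gridWeight m (t + 3) * gridLogDeriv m (t + 3) * R.eval ((t + 3 : ℕ) : ℂ) +
        gridWeight m (t + 3) * (derivative R).eval ((t + 3 : ℕ) : ℂ)) := by
    rw [← hT', hTR, gridNodal_eq_mul hlm, mul_assoc]
    simp only [derivative_mul, derivative_add, derivative_sub, derivative_X, derivative_C,
      eval_mul, eval_add, eval_sub, eval_X, eval_C, derivative_one, eval_one, eval_zero,
      derivative_zero, eval_derivative_gridNodalErase_self hlm, eval_gridNodalErase_self]
    ring
  rw [hQ2, hReval _ hlm, ← hS]
  have e : gridWeight m (t + 3) * gridLogDeriv m (t + 3) *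
      (-1 / (2 * (m.factorial : ℂ)) * m.choose (t + 3)) =
      gridLogDeriv m (t + 3) * (-(-1) ^ t / 2) := by
    field_simp
    linear_combination (-gridLogDeriv m (t + 3)) * hw
  rw [e]
  linear_combination (2 * (derivative R).eval ((t + 3 : ℕ) : ℂ)) * hw

lemma fourierMode_pi (j : ℤ) : fourierMode Real.pi j = (-1) ^ j := by
  rw [fourierMode, show Complex.I * (j : ℂ) * (Real.pi : ℂ) = (j : ℂ) * (Real.pi * Complex.I) by
    ring, Complex.exp_int_mul, Complex.exp_pi_mul_I]

/-- The action of the method on grid functions proportional to `(-1) ^ j`. -/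
lemma exists_sawtooth_symbol (t : ℕ) {h : ℝ} (hh : 0 < h) :
    ∃ a b c d : ℂ, 0 < (a + d).re ∧ ∀ (U V : ℂ) (j : ℤ),
      rhsU (t + 3) t h (fun j => U * (-1) ^ j) (fun j => V * (-1) ^ j) j =
        (a * U + b * V) * (-1) ^ j ∧
      rhsV (t + 3) t h (fun j => U * (-1) ^ j) (fun j => V * (-1) ^ j) j =
        (c * U + d * V) * (-1) ^ j := by
  have hc : (h : ℂ) ≠ 0 := by exact_mod_cast hh.ne'
  obtain ⟨Q₁, hd₁, h₁⟩ := exists_hermite_differences (2 * t + 3) (fun i => (-1) ^ (i + 1)) 0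
  obtain ⟨Q₂, hd₂, h₂⟩ := exists_hermite_differences (2 * t + 3) 0 (fun i => (-1) ^ (i + 1))
  have v₁ := eval_derivative_of_alternating_values ⟨t + 1, by ring⟩ Q₁ hd₁ h₁
    (show t + 3 ≤ 2 * t + 3 by omega)
  have v₂ := eval_derivative2_of_alternating_derivatives t Q₂ hd₂ h₂
  have sum_eq := alternating_harmonic_choose_sq (t + 1)
  simp only [mul_right_comm _ (harmonic _)] at sum_eq
  rw [show 2 * (t + 1) + 2 = 2 * t + 3 + 1 by ring, show 2 * (t + 1) + 1 = 2 * t + 3 by ring]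
    at sum_eq
  rw [sum_eq] at v₁
  have hsq : ((-1 : ℂ) ^ t) * (-1) ^ t = 1 := by rw [← mul_pow]; simp
  set p : ℝ := 2 * (2 ^ (4 * (t + 1)) * ((t + 1).factorial : ℝ) ^ 2 / ((2 * t + 3).factorial : ℝ)) /
    Nat.centralBinom (2 * t + 3) with hp
  set q : ℝ := (2 * ((t : ℝ) + 2) / (t + 1) - (t + 1) / (t + 2)) / (t + 3) /
    (2 * t + 3).choose (t + 3) with hq
  have hp0 : 0 < p := by
    have := Nat.centralBinom_pos (2 * t + 3)
    positivity
  have hq0 : 0 < q := by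
    have h1 : 0 < (2 * t + 3).choose (t + 3) := Nat.choose_pos (by omega)
    have h2 : ((t : ℝ) + 1) / (t + 2) < 2 * (t + 2) / (t + 1) := by
      rw [div_lt_div_iff₀ (by positivity) (by positivity)]
      nlinarith [(Nat.cast_nonneg t : (0 : ℝ) ≤ t)]
    have h3 : 0 < 2 * ((t : ℝ) + 2) / (t + 1) - (t + 1) / (t + 2) := sub_pos.2 h2
    positivity
  have e₁ : (derivative Q₁).eval ((t + 3 : ℕ) : ℂ) = (-1) ^ t * p := by
    rw [eq_div_of_mul_eq (centralBinom_cast_ne_zero _) v₁, hp]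
    push_cast
    rw [pow_succ, pow_succ]
    ring
  have e₂ : (derivative (derivative Q₂)).eval ((t + 3 : ℕ) : ℂ) = (-1) ^ t * q := by
    have h1 : (((2 * t + 3).choose (t + 3) : ℕ) : ℂ) ≠ 0 := by
      exact_mod_cast (Nat.choose_pos (by omega)).ne'
    rw [eq_div_of_mul_eq h1 v₂, hq]
    push_cast
    ring
  -- By linearity `Q₁` and `Q₂` suffice; the prefactor is the phase of the leftmost stencil cell `j
  -- - (t + 3) + 1` relative to the normalized data.
  have hrec : ∀ (U V : ℂ) (j : ℤ), IsUnitReconstruction (t + 3) t h (fun j => U * (-1) ^ j)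
      (fun j => V * (-1) ^ j) j
      (C (-(-1) ^ j * (-1) ^ t * U) * Q₁ + C (-(-1) ^ j * (-1) ^ t * (h * V)) * Q₂) := by
    intro U V j
    refine ⟨?_, fun i hi => ?_⟩
    · rw [show t + 3 + t = 2 * t + 3 by ring, ← smul_eq_C_mul, ← smul_eq_C_mul]
      exact (degree_add_le _ _).trans_lt (max_lt ((degree_smul_le _ _).trans_lt hd₁)
        ((degree_smul_le _ _).trans_lt hd₂))
    · have hz : (-1 : ℂ) ^ (j - ((t + 3 : ℕ) : ℤ) + 1 + i) = -(-1) ^ j * (-1) ^ t * (-1) ^ (i + 1) := by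
        have n0 : (-1 : ℂ) ≠ 0 := by norm_num
        rw [zpow_add₀ n0, zpow_add₀ n0, zpow_sub₀ n0, zpow_natCast, zpow_natCast, zpow_one,
          pow_add, pow_succ]
        field_simp
        linear_combination (-(-1 : ℂ) ^ i) * hsq
      have g₁ := h₁ i (by omega)
      have g₂ := h₂ i (by omega)
      simp only [Pi.zero_apply] at g₁ g₂
      simp only [hz, derivative_add, derivative_C_mul, eval_add, eval_mul, eval_C]
      exact ⟨by linear_combination (-(-1) ^ j * (-1) ^ t * U) * g₁.1 +
          (-(-1) ^ j * (-1) ^ t * (h * V)) * g₂.1,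
        by linear_combination (-(-1) ^ j * (-1) ^ t * U) * g₁.2 +
          (-(-1) ^ j * (-1) ^ t * (h * V)) * g₂.2⟩
  have hF : ∀ (U V : ℂ) (j : ℤ), fluxF (t + 3) t h (fun j => U * (-1) ^ j)
      (fun j => V * (-1) ^ j) j = -(-1) ^ j *
        (p * U + (-1) ^ t * h * (derivative Q₂).eval ((t + 3 : ℕ) : ℂ) * V) := by
    intro U V j
    rw [(hrec U V j).fluxF_eq hh.ne']
    simp only [derivative_add, derivative_C_mul, eval_add, eval_mul, eval_C]
    rw [e₁]
    linear_combination (-(-1) ^ j * U * p) * hsq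
  have hH : ∀ (U V : ℂ) (j : ℤ), fluxH (t + 3) t h (fun j => U * (-1) ^ j)
      (fun j => V * (-1) ^ j) j = -(-1) ^ j *
        ((-1) ^ t / h * (derivative (derivative Q₁)).eval ((t + 3 : ℕ) : ℂ) * U + q * V) := by
    intro U V j
    rw [(hrec U V j).fluxH_eq hh.ne']
    simp only [derivative_add, derivative_C_mul, eval_add, eval_mul, eval_C]
    rw [e₂]
    field_simp
    linear_combination (-V * h * q) * hsq
  have hshift : ∀ j : ℤ, (-1 : ℂ) ^ (j - 1) = -(-1) ^ j := by
    intro j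
    rw [zpow_sub₀ (by norm_num), zpow_one]
    ring
  -- The flux changes sign between neighbouring faces, whence the factor 2. The off-diagonal entries
  -- need not be evaluated.
  refine ⟨2 * p / h, 2 / h * ((-1) ^ t * h * (derivative Q₂).eval ((t + 3 : ℕ) : ℂ)),
    2 / h * ((-1) ^ t / h * (derivative (derivative Q₁)).eval ((t + 3 : ℕ) : ℂ)), 2 * q / h,
    ?_, fun U V j => ⟨?_, ?_⟩⟩
  · have : (2 * p / h + 2 * q / h : ℂ) = ((2 * p / h + 2 * q / h : ℝ) : ℂ) := by push_cast; rfl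
    rw [this, Complex.ofReal_re]
    positivity
  · rw [rhsU, hF, hF, hshift]
    ring
  · rw [rhsV, hH, hH, hshift]
    ring

/-! ### Positive trace and instability -/

/-- A complex `2 × 2` matrix whose trace has positive real part has an eigenvalue with positive
real part. -/
lemma exists_eigenvalue_re_pos (a b c d : ℂ) (h : 0 < (a + d).re) :
    ∃ μ U V : ℂ, 0 < μ.re ∧ ¬(U = 0 ∧ V = 0) ∧ a * U + b * V = μ * U ∧ c * U + d * V = μ * V := by
  -- A square root of the discriminant with nonnegative real part; the eigenvalue is half the trace
  -- plus `z / 2`.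
  obtain ⟨z, hz, hz0⟩ : ∃ z : ℂ, z ^ 2 = (a - d) ^ 2 + 4 * b * c ∧ 0 ≤ z.re := by
    obtain ⟨z, hz⟩ := IsAlgClosed.exists_pow_nat_eq ((a - d) ^ 2 + 4 * b * c) (n := 2) (by norm_num)
    rcases le_total 0 z.re with h0 | h0
    · exact ⟨z, hz, h0⟩
    · exact ⟨-z, by rw [neg_sq, hz], by simpa using h0⟩
  set μ : ℂ := (a + d + z) / 2 with hμ
  have hdet : (!![a - μ, b; c, d - μ]).det = 0 := by
    rw [Matrix.det_fin_two_of, hμ]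
    linear_combination hz / 4
  obtain ⟨w, hw, hw0⟩ := Matrix.exists_mulVec_eq_zero_iff.2 hdet
  have e₁ := congrFun hw0 0
  have e₂ := congrFun hw0 1
  simp only [Matrix.mulVec, dotProduct, Fin.sum_univ_two, Matrix.of_apply, Matrix.cons_val_zero,
    Matrix.cons_val_one, Matrix.cons_val', Matrix.cons_val_fin_one, Pi.zero_apply] at e₁ e₂
  refine ⟨μ, w 0, w 1, ?_, fun hUV => hw ?_, by linear_combination e₁, by linear_combination e₂⟩
  · rw [hμ, show (a + d + z) / 2 = ((1 / 2 : ℝ) : ℂ) * (a + d + z) by push_cast; ring,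
      Complex.re_ofReal_mul, Complex.add_re]
    linarith
  · funext i
    fin_cases i
    · exact hUV.1
    · exact hUV.2

theorem traceSymbol_pi_re_neg (t : ℕ) {h : ℝ} (hh : 0 < h) :
    (traceSymbol (t + 3) t h Real.pi).re < 0 := by
  have hc : (h : ℂ) ≠ 0 := by exact_mod_cast hh.ne'
  obtain ⟨a, b, c, d, hre, H⟩ := exists_sawtooth_symbol t hh
  have hmode : fourierMode Real.pi = fun j => (1 : ℂ) * (-1) ^ j := by
    funext j; rw [fourierMode_pi, one_mul]
  have hzero : (0 : ℤ → ℂ) = fun j => (0 : ℂ) * (-1) ^ j := by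
    funext j; simp
  set s : ℂ := Complex.I * ((Real.pi / h : ℝ) : ℂ) with hs
  have hs0 : s ≠ 0 := by
    refine mul_ne_zero Complex.I_ne_zero ?_
    exact_mod_cast (div_pos Real.pi_pos hh).ne'
  have hsm : s • fourierMode Real.pi = fun j => s * (-1) ^ j := by
    funext j; simp [fourierMode_pi]
  have h1 : rhsU (t + 3) t h (fourierMode Real.pi) 0 0 = a := by
    rw [hmode, hzero, (H 1 0 0).1]; simp
  have h2 : rhsV (t + 3) t h 0 (s • fourierMode Real.pi) 0 = d * s := by
    rw [hsm, hzero, (H 0 s 0).2]; simp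
  -- The scaling by iκ cancels on the diagonal, and the convention `-1/h` reverses the sign of the
  -- trace.
  have : traceSymbol (t + 3) t h Real.pi = ((-h : ℝ) : ℂ) * (a + d) := by
    simp only [traceSymbol, symbolMatrix, Matrix.trace_smul, Matrix.trace_fin_two_of]
    rw [← hs, h1, h2, mul_div_cancel_right₀ _ hs0]
    simp
  rw [this, Complex.re_ofReal_mul]
  exact mul_neg_of_neg_of_pos (neg_neg_of_pos hh) hre

theorem isUnstableOnGrid_of_even (t : ℕ) {h : ℝ} (hh : 0 < h) {N : ℕ} (hN : Even N) :
    IsUnstableOnGrid (t + 3) t N h := by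
  obtain ⟨a, b, c, d, hre, H⟩ := exists_sawtooth_symbol t hh
  obtain ⟨μ, U, V, hμ, hUV, e₁, e₂⟩ := exists_eigenvalue_re_pos a b c d hre
  have hper : ∀ j : ℤ, (-1 : ℂ) ^ (j + N) = (-1) ^ j := by
    intro j
    rw [zpow_add₀ (by norm_num), zpow_natCast, hN.neg_one_pow, mul_one]
  refine ⟨μ, ⟨fun j => U * (-1) ^ j, fun j => V * (-1) ^ j, fun j => ?_, fun j => ?_, ?_,
    fun j => ⟨?_, ?_⟩⟩, hμ⟩
  · simp only [hper]
  · simp only [hper]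
  · rintro ⟨hU, hV⟩
    exact hUV ⟨by simpa using congrFun hU 0, by simpa using congrFun hV 0⟩
  · rw [(H U V j).1, e₁]; ring
  · rw [(H U V j).2, e₂]; ring

theorem theorem4 (t : ℕ) :
    (∀ (h : ℝ), 0 < h → ∀ (u v : ℤ → ℂ) (j : ℤ),
      ∃! P : Polynomial ℂ, IsReconstruction (t + 3) t h u v j P) ∧
    (∀ (h : ℝ), 0 < h → (traceSymbol (t + 3) t h Real.pi).re < 0) ∧
    (∀ (h : ℝ), 0 < h → ∀ (N : ℕ), 0 < N → Even N → IsUnstableOnGrid (t + 3) t N h) ∧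
    (∀ n : ℕ, ∑ k ∈ Finset.range (2 * n + 2),
        (-1 : ℚ) ^ k * harmonic k * ((2 * n + 1).choose k : ℚ) ^ 2 =
      (-1 : ℚ) ^ (n + 1) * 2 ^ (4 * n) * (n.factorial : ℚ) ^ 2 / ((2 * n + 1).factorial : ℚ)) :=
  ⟨fun _ hh u v j => existsUnique_isReconstruction _ _ hh.ne' u v j,
    fun _ hh => traceSymbol_pi_re_neg t hh,
    fun _ hh _ _ hN => isUnstableOnGrid_of_even t hh hN,
    alternating_harmonic_choose_sq⟩
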